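/- A function $f:(0,\infty)\to\mathbb{R}$ is called a complete Bernstein function if $$f(z)=c_1+c_2z+\int_0^\infty(1-e^{-zs})\,m(s)\,ds,\qquad z>0,$$ for some constants $c_1,c_2\ge 0$ and some function $m$ that is completely monotone on $(0,\infty)$ (that is, smooth with $(-1)^n m^{(n)}(s)\ge 0$ for all $s>0$ and $n=0,1,2,\dots$) and satisfies $\int_0^\infty\min(1,s)\,m(s)\,ds<\infty$. Lemma. Let $\psi$ be a complete Bernstein function that is not identically zero. Then $\psi>0$ on $(0,\infty)$, the integral in $$\psi^\dagger(\xi)=\exp\left(\frac1\pi\int_0^\infty\frac{\log\psi(\xi^2\zeta^2)}{1+\zeta^2}\,d\zeta\right),\qquad \xi>0,$$ converges absolutely for every $\xi>0$, and $\psi^\dagger$ is again a complete Bernstein function. Moreover, $\psi$ and $\psi^\dagger$ extend to holomorphic functions on $\mathbb{C}\setminus(-\infty,0]$, and these extensions (denoted by the same symbols) satisfy $$\psi^\dagger(\xi)\,\psi^\dagger(-\xi)=\psi(-\xi^2),\qquad \xi\in\mathbb{C}\setminus\mathbb{R}.$$ -/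

import Mathlib

open Set MeasureTheory

/-- A function is completely monotone on `(0, ∞)` if it is smooth there and
`(-1)ⁿ g⁽ⁿ⁾(s) ≥ 0` for all `s > 0` and all `n`. Values outside `(0, ∞)` are irrelevant. -/
structure IsCompletelyMonotone (g : ℝ → ℝ) : Prop where
  contDiffOn : ContDiffOn ℝ ((⊤ : ℕ∞) : WithTop ℕ∞) g (Ioi 0)
  nonneg : ∀ n : ℕ, ∀ s : ℝ, 0 < s → 0 ≤ (-1) ^ n * iteratedDeriv n g s

/-- A function `f` on `(0, ∞)` is a complete Bernstein function if
`f(z) = c₁ + c₂ z + ∫₀^∞ (1 - e^{-zs}) m(s) ds` for `z > 0`, with constants `c₁, c₂ ≥ 0` and a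
density `m`, completely monotone on `(0, ∞)`, such that `∫₀^∞ min(1, s) m(s) ds < ∞`.
Values of `f` outside `(0, ∞)` are irrelevant. -/
def IsCompleteBernstein (f : ℝ → ℝ) : Prop :=
  ∃ (c₁ c₂ : ℝ) (m : ℝ → ℝ), 0 ≤ c₁ ∧ 0 ≤ c₂ ∧ IsCompletelyMonotone m ∧
    IntegrableOn (fun s : ℝ => min 1 s * m s) (Ioi 0) ∧
    ∀ z : ℝ, 0 < z →
      f z = c₁ + c₂ * z + ∫ s in Ioi (0 : ℝ), (1 - Real.exp (-(z * s))) * m s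

/-- `ψ†(ξ) = exp((1/π) ∫₀^∞ log ψ(ξ²ζ²) / (1 + ζ²) dζ)`, meant for `ξ > 0`. -/
noncomputable def dagger (ψ : ℝ → ℝ) (ξ : ℝ) : ℝ :=
  Real.exp ((1 / Real.pi) *
    ∫ ζ in Ioi (0 : ℝ), Real.log (ψ (ξ ^ 2 * ζ ^ 2)) / (1 + ζ ^ 2))

/-- `F` is a holomorphic extension of `f`, given on `(0, ∞)`, to the slit plane `ℂ ∖ (-∞, 0]`. -/
structure IsHolomorphicExtension (f : ℝ → ℝ) (F : ℂ → ℂ) : Prop where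
  differentiableOn : DifferentiableOn ℂ F Complex.slitPlane
  eq_ofReal : ∀ x : ℝ, 0 < x → F (x : ℂ) = (f x : ℂ)

/-! The class of complete Bernstein functions coincides with the class of superpositions of the
kernels `z / ((1 - u) z + u)` against finite measures on the compact interval `[0, 1]`
(`IsCompleteBernstein.isPick`, `IsPick.isCompleteBernstein`). Each kernel equals `1` at `z = 1`, so
the value there is the total mass. Pointwise convergence on the half-line therefore bounds the
masses, and weak compactness makes the class closed under such limits (`IsPick.of_tendsto`). The
superpositions are holomorphic on the slit plane, which gives the extensions.

Bernstein's theorem is not invoked: a completely monotone `m` equals its Taylor series at `b` on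
`(0, b)`, a series in `1 - s / b` with nonnegative coefficients. If `exp (-x s)` is replaced by `(1
- s / b) ^ (b x)`, each term integrates to a nonnegative multiple of a kernel; then `b → ∞`.

Discretizing the measure approximates `ψ` by rational functions `C ∏ (z + αᵢ) / (z + sᵢ)` with
interlacing `αᵢ`, `sᵢ` (`exists_tendsto_prod`). For these, `ψ†(ξ) = √C ∏ (ξ + √αᵢ) / (ξ + √sᵢ)`
(`dagger_prod`). Square roots preserve interlacing, so partial fractions have coefficients of the
right sign and `ψ†` is again a superposition. The factorization reduces to `(√α + ξ)(√α - ξ) = α -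
ξ²`.

In the limit, dominated convergence handles `ψ†` on the half-line. Weak convergence of the
representing measures along an ultrafilter carries the factorization to complex arguments, since
kernels are continuous in `u` at every point of the slit plane. -/

open Filter Topology
open scoped unitInterval NNReal

/-! ### Integral transforms of finite measures on the unit interval -/

/-- The extreme rays `z ↦ z / ((1 - u) z + u)`, `u ∈ [0, 1]`, of the cone of complete Bernstein
functions. -/
noncomputable def pickKernel (z : ℂ) (u : I) : ℂ := z / ((1 - (u : ℝ)) * z + (u : ℝ))

/-- The superposition of the functions `z ↦ z / ((1 - u) z + u)` with respect to a measure. -/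
noncomputable def pickTransform (ρ : Measure I) (z : ℂ) : ℂ := ∫ u, pickKernel z u ∂ρ

/-- `f` is, on `(0, ∞)`, a superposition of the functions `z ↦ z / ((1 - u) z + u)`. -/
def IsPick (f : ℝ → ℝ) : Prop :=
  ∃ ρ : FiniteMeasure I, ∀ x : ℝ, 0 < x → (f x : ℂ) = pickTransform ρ x

/-- The denominator runs along the segment from `z` to `1`, and the slit plane is star-shaped about
`1`. -/
lemma pickKernel_denom_mem_slitPlane {z : ℂ} (hz : z ∈ Complex.slitPlane) (u : I) :
    (1 - (u : ℝ)) * z + (u : ℝ) ∈ Complex.slitPlane := by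
  have h0 := u.2.1
  have h1 := u.2.2
  rw [Complex.mem_slitPlane_iff] at hz ⊢
  have hre : ((1 - ((u : ℝ) : ℂ)) * z + ((u : ℝ) : ℂ)).re = (1 - (u : ℝ)) * z.re + u := by simp
  have him : ((1 - ((u : ℝ) : ℂ)) * z + ((u : ℝ) : ℂ)).im = (1 - (u : ℝ)) * z.im := by simp
  rw [hre, him]
  rcases eq_or_lt_of_le h1 with h | h
  · left; rw [h]; simp
  · rcases hz with hz | hz
    · left
      have : 0 < (1 - (u : ℝ)) * z.re := mul_pos (by linarith) hz
      linarith
    · right; exact mul_ne_zero (by linarith) hz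

lemma pickKernel_denom_ne_zero {z : ℂ} (hz : z ∈ Complex.slitPlane) (u : I) :
    (1 - ((u : ℝ) : ℂ)) * z + ((u : ℝ) : ℂ) ≠ 0 :=
  Complex.slitPlane_ne_zero (pickKernel_denom_mem_slitPlane hz u)

lemma continuous_pickKernel {z : ℂ} (hz : z ∈ Complex.slitPlane) : Continuous (pickKernel z) := by
  unfold pickKernel
  exact continuous_const.div (by fun_prop) (pickKernel_denom_ne_zero hz)

lemma integrable_pickKernel {z : ℂ} (hz : z ∈ Complex.slitPlane) (ρ : Measure I)
    [IsFiniteMeasure ρ] : Integrable (pickKernel z) ρ :=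
  (continuous_pickKernel hz).integrable_of_hasCompactSupport
    (HasCompactSupport.of_compactSpace _)

lemma differentiableOn_pickTransform (ρ : Measure I) [IsFiniteMeasure ρ] :
    DifferentiableOn ℂ (pickTransform ρ) Complex.slitPlane := by
  intro z₀ hz₀
  obtain ⟨ε, hε, hball⟩ := Metric.nhds_basis_closedBall.mem_iff.1
    (Complex.isOpen_slitPlane.mem_nhds hz₀)
  -- The `z`-derivative of the kernel; compactness of closed ball times `[0, 1]` gives it a uniform
  -- bound.
  let D : ℂ → I → ℂ := fun z u => ((u : ℝ) : ℂ) / ((1 - ((u : ℝ) : ℂ)) * z + ((u : ℝ) : ℂ)) ^ 2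
  have hcont : ContinuousOn (fun p : ℂ × I => D p.1 p.2) (Metric.closedBall z₀ ε ×ˢ univ) := by
    refine ContinuousOn.div (by fun_prop) (by fun_prop) ?_
    rintro ⟨z, u⟩ ⟨hz, -⟩
    exact pow_ne_zero _ (pickKernel_denom_ne_zero (hball hz) u)
  obtain ⟨C, hC⟩ := ((isCompact_closedBall z₀ ε).prod isCompact_univ).exists_bound_of_continuousOn
    hcont
  have hder : ∀ z ∈ Metric.closedBall z₀ ε, ∀ u : I,
      HasDerivAt (fun z => pickKernel z u) (D z u) z := by
    intro z hz u
    have hne := pickKernel_denom_ne_zero (hball hz) u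
    have h1 : HasDerivAt (fun z : ℂ => (1 - ((u : ℝ) : ℂ)) * z + ((u : ℝ) : ℂ))
        ((1 - ((u : ℝ) : ℂ)) * 1) z := ((hasDerivAt_id z).const_mul _).add_const _
    have h2 := (hasDerivAt_id z).div h1 hne
    refine h2.congr_deriv ?_
    simp only [D, id]
    congr 1
    ring
  have key := hasDerivAt_integral_of_dominated_loc_of_deriv_le (μ := ρ) (𝕜 := ℂ)
    (F := fun z u => pickKernel z u) (F' := D) (x₀ := z₀) (s := Metric.ball z₀ ε)
    (bound := fun _ => C) (Metric.ball_mem_nhds z₀ hε) ?_ ?_ ?_ ?_ ?_ ?_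
  · exact key.2.differentiableAt.differentiableWithinAt
  · filter_upwards [Metric.ball_mem_nhds z₀ hε] with z hz
    exact (continuous_pickKernel
      (hball (Metric.ball_subset_closedBall hz))).aestronglyMeasurable
  · exact integrable_pickKernel hz₀ ρ
  · refine Continuous.aestronglyMeasurable ?_
    exact continuousOn_univ.1 (hcont.comp (f := fun u : I => (z₀, u))
      (by fun_prop) fun u _ => ⟨Metric.mem_closedBall_self hε.le, mem_univ _⟩)
  · exact Eventually.of_forall fun u z hz => hC (z, u) ⟨Metric.ball_subset_closedBall hz, mem_univ _⟩
  · exact integrable_const _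
  · exact Eventually.of_forall fun u z hz => hder z (Metric.ball_subset_closedBall hz) u

lemma ofReal_mem_slitPlane {x : ℝ} (hx : 0 < x) : (x : ℂ) ∈ Complex.slitPlane :=
  Complex.ofReal_mem_slitPlane.2 hx

lemma pickKernel_ofReal (x : ℝ) (u : I) :
    pickKernel x u = ((x / ((1 - u) * x + u) : ℝ) : ℂ) := by
  simp [pickKernel]

lemma pickKernel_real_denom_pos {x : ℝ} (hx : 0 < x) (u : I) : 0 < (1 - (u : ℝ)) * x + u := by
  have h0 := u.2.1
  have h1 := u.2.2
  rcases eq_or_lt_of_le h1 with h | h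
  · rw [h]; simp
  · have : 0 < (1 - (u : ℝ)) * x := mul_pos (by linarith) hx
    linarith

lemma continuous_pickKernel_real {x : ℝ} (hx : 0 < x) :
    Continuous fun u : I => x / ((1 - (u : ℝ)) * x + u) :=
  continuous_const.div (by fun_prop) fun u => (pickKernel_real_denom_pos hx u).ne'

lemma integrable_pickKernel_real {x : ℝ} (hx : 0 < x) (ρ : Measure I) [IsFiniteMeasure ρ] :
    Integrable (fun u : I => x / ((1 - (u : ℝ)) * x + u)) ρ :=
  (continuous_pickKernel_real hx).integrable_of_hasCompactSupport
    (HasCompactSupport.of_compactSpace _)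

lemma pickTransform_ofReal (ρ : Measure I) (x : ℝ) :
    pickTransform ρ x = ((∫ u : I, x / ((1 - u) * x + u) ∂ρ : ℝ) : ℂ) := by
  simp_rw [pickTransform, pickKernel_ofReal]
  exact integral_ofReal

/-- For `x > 0` the kernel is the harmonic mean of `1` and `x` with weights `1 - u` and `u`. -/
lemma min_le_pickKernel {x : ℝ} (hx : 0 < x) (u : I) :
    min 1 x ≤ x / ((1 - (u : ℝ)) * x + u) := by
  have h0 := u.2.1
  have h1 := u.2.2
  rw [le_div_iff₀ (pickKernel_real_denom_pos hx u)]
  rcases le_total 1 x with h | h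
  · rw [min_eq_left h]; nlinarith
  · rw [min_eq_right h]
    have : (1 - (u : ℝ)) * x + u ≤ 1 := by nlinarith
    nlinarith

lemma pickKernel_le_max {x : ℝ} (hx : 0 < x) (u : I) :
    x / ((1 - (u : ℝ)) * x + u) ≤ max 1 x := by
  have h0 := u.2.1
  have h1 := u.2.2
  rw [div_le_iff₀ (pickKernel_real_denom_pos hx u)]
  rcases le_total 1 x with h | h
  · rw [max_eq_right h]
    have : 1 ≤ (1 - (u : ℝ)) * x + u := by nlinarith
    nlinarith
  · rw [max_eq_left h]; nlinarith

namespace IsPick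

/-- `f 1` is the mass of the measure and every kernel lies between `min 1 x` and `max 1 x`. This
yields the positivity dichotomy and the logarithmic growth bound used for `ψ†`. -/
lemma bounds {f : ℝ → ℝ} (hf : IsPick f) {x : ℝ} (hx : 0 < x) :
    f 1 * min 1 x ≤ f x ∧ f x ≤ f 1 * max 1 x := by
  obtain ⟨ρ, hρ⟩ := hf
  have hval : ∀ y : ℝ, 0 < y → f y = ∫ u : I, y / ((1 - u) * y + u) ∂(ρ : Measure I) := by
    intro y hy
    have := hρ y hy
    rw [pickTransform_ofReal] at this
    exact_mod_cast this
  have h1 : f 1 = (ρ : Measure I).real univ := by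
    rw [hval 1 one_pos]; simp
  have hint := integrable_pickKernel_real hx (ρ : Measure I)
  constructor
  · have := integral_mono (integrable_const (min 1 x)) hint (min_le_pickKernel hx)
    rw [hval x hx, h1]
    simpa using this
  · have := integral_mono hint (integrable_const (max 1 x)) (pickKernel_le_max hx)
    rw [hval x hx, h1]
    simpa using this

lemma nonneg {f : ℝ → ℝ} (hf : IsPick f) {x : ℝ} (hx : 0 < x) : 0 ≤ f x := by
  have h1 : 0 ≤ f 1 := by
    have := hf.bounds (x := 2) two_pos
    norm_num at this
    linarith
  exact le_trans (mul_nonneg h1 (le_min zero_le_one hx.le)) (hf.bounds hx).1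

end IsPick

lemma pickTransform_one (ρ : FiniteMeasure I) : pickTransform ρ 1 = ρ.mass := by
  have h := pickTransform_ofReal (ρ : Measure I) 1
  rw [Complex.ofReal_one] at h
  have h2 : ∀ u : I, (1 : ℝ) / ((1 - (u : ℝ)) * 1 + u) = 1 := fun u => by
    rw [mul_one, sub_add_cancel, div_one]
  rw [h, integral_congr_ae (Eventually.of_forall h2), integral_const, smul_eq_mul, mul_one]
  rfl

lemma tendsto_pickTransform {ι : Type*} {l : Filter ι} {ρs : ι → FiniteMeasure I}
    {ρ : FiniteMeasure I} (h : Tendsto ρs l (𝓝 ρ)) {z : ℂ} (hz : z ∈ Complex.slitPlane) :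
    Tendsto (fun i => pickTransform (ρs i) z) l (𝓝 (pickTransform ρ z)) := by
  have := (FiniteMeasure.tendsto_iff_forall_integral_rclike_tendsto ℂ).1 h
    (BoundedContinuousFunction.mkOfCompact ⟨pickKernel z, continuous_pickKernel hz⟩)
  simpa [pickTransform] using this

/-- Sequential compactness (along an ultrafilter) of bounded sets of finite measures, in terms of
their transforms. -/
lemma exists_ultrafilter_tendsto_finiteMeasure (ρs : ℕ → FiniteMeasure I)
    {f : ℝ → ℝ} (hf : ∀ x : ℝ, 0 < x →
      Tendsto (fun n => pickTransform (ρs n) x) atTop (𝓝 (f x : ℂ))) :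
    ∃ (U : Ultrafilter ℕ) (ρ : FiniteMeasure I), (U : Filter ℕ) ≤ atTop ∧
      Tendsto ρs U (𝓝 ρ) ∧ ∀ x : ℝ, 0 < x → (f x : ℂ) = pickTransform ρ x := by
  have h1 := hf 1 one_pos
  simp only [Complex.ofReal_one, pickTransform_one] at h1
  -- Convergence at `x = 1` is convergence of the masses, hence a common mass bound.
  have h1' : Tendsto (fun n => ((ρs n).mass : ℝ)) atTop (𝓝 (f 1)) := by
    have := (Complex.continuous_re.tendsto _).comp h1
    simpa [Function.comp_def] using this
  obtain ⟨C, hC⟩ := h1'.bddAbove_range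
  have hK := isCompact_setOfPred_finiteMeasure_le_of_compactSpace I C.toNNReal
  obtain ⟨ρ, -, hρ⟩ := hK.ultrafilter_le_nhds ((Ultrafilter.of atTop).map ρs) (by
    rw [Filter.le_principal_iff]
    refine Filter.mem_map.2 (Filter.univ_mem' fun n => ?_)
    have h2 : ((ρs n).mass : ℝ) ≤ C := hC ⟨n, rfl⟩
    exact NNReal.le_toNNReal_of_coe_le h2)
  refine ⟨Ultrafilter.of atTop, ρ, Ultrafilter.of_le _, hρ, fun x hx => ?_⟩
  exact tendsto_nhds_unique ((hf x hx).mono_left (Ultrafilter.of_le _))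
    (tendsto_pickTransform hρ (ofReal_mem_slitPlane hx))

namespace IsPick

lemma of_tendsto {fs : ℕ → ℝ → ℝ} {f : ℝ → ℝ} (hfs : ∀ n, IsPick (fs n))
    (hf : ∀ x : ℝ, 0 < x → Tendsto (fun n => fs n x) atTop (𝓝 (f x))) : IsPick f := by
  choose ρs hρs using hfs
  obtain ⟨-, ρ, -, -, hρ⟩ := exists_ultrafilter_tendsto_finiteMeasure ρs (f := f) fun x hx => by
    simp_rw [← hρs _ x hx]
    exact (Complex.continuous_ofReal.tendsto _).comp (hf x hx)
  exact ⟨ρ, hρ⟩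

lemma add {f g : ℝ → ℝ} (hf : IsPick f) (hg : IsPick g) : IsPick fun x => f x + g x := by
  obtain ⟨ρ, hρ⟩ := hf
  obtain ⟨τ, hτ⟩ := hg
  refine ⟨ρ + τ, fun x hx => ?_⟩
  have hs := ofReal_mem_slitPlane hx
  rw [Complex.ofReal_add, hρ x hx, hτ x hx]
  exact (integral_add_measure (integrable_pickKernel hs _) (integrable_pickKernel hs _)).symm

lemma smul_kernel {c : ℝ} (hc : 0 ≤ c) (u : I) :
    IsPick fun x => c * (x / ((1 - (u : ℝ)) * x + u)) := by
  obtain ⟨δ, hδ⟩ : ∃ δ : FiniteMeasure I, (δ : Measure I) = Measure.dirac u :=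
    ⟨⟨Measure.dirac u, inferInstance⟩, rfl⟩
  refine ⟨c.toNNReal • δ, fun x _ => ?_⟩
  have : pickTransform ((c.toNNReal • δ : FiniteMeasure I) : Measure I) x
      = (c : ℂ) * pickKernel x u := by
    rw [pickTransform, FiniteMeasure.toMeasure_smul, integral_smul_nnreal_measure, hδ]
    simp [integral_dirac, NNReal.smul_def, hc]
  rw [this, pickKernel_ofReal]
  push_cast
  rfl

lemma const {c : ℝ} (hc : 0 ≤ c) : IsPick fun _ => c := by
  obtain ⟨ρ, hρ⟩ := smul_kernel hc 0
  refine ⟨ρ, fun x hx => ?_⟩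
  rw [← hρ x hx]
  simp [hx.ne']

lemma linear {c : ℝ} (hc : 0 ≤ c) : IsPick fun x => c * x := by
  obtain ⟨ρ, hρ⟩ := smul_kernel hc 1
  refine ⟨ρ, fun x hx => ?_⟩
  rw [← hρ x hx]
  simp

lemma div_add {a s : ℝ} (ha : 0 ≤ a) (hs : 0 ≤ s) : IsPick fun x => a * (x / (x + s)) := by
  have h1 : 0 < 1 + s := by linarith
  obtain ⟨ρ, hρ⟩ := smul_kernel (c := a / (1 + s)) (by positivity)
    -- The point of the interval whose rate `u / (1 - u)` is `s`.
    ⟨s / (1 + s), by positivity, (div_le_one h1).2 (by linarith)⟩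
  refine ⟨ρ, fun x hx => ?_⟩
  rw [← hρ x hx]
  congr 1
  have : (1 - s / (1 + s)) * x + s / (1 + s) = (x + s) / (1 + s) := by field_simp; ring
  simp only [this]
  have : 0 < x + s := by linarith
  field_simp

lemma sum {ι : Type*} (t : Finset ι) {f : ι → ℝ → ℝ} (hf : ∀ i ∈ t, IsPick (f i)) :
    IsPick fun x => ∑ i ∈ t, f i x := by
  classical
  induction t using Finset.induction_on with
  | empty => simpa using const le_rfl
  | insert i t hi ih =>
    simp_rw [Finset.sum_insert hi]
    exact (hf i (Finset.mem_insert_self _ _)).add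
      (ih fun j hj => hf j (Finset.mem_insert_of_mem hj))

end IsPick

/-! ### Superpositions of the kernels are complete Bernstein functions -/

/-- The exponential rate attached to a point of the unit interval; it vanishes at both ends. -/
noncomputable def pickRate (u : I) : ℝ := u / (1 - u)

lemma pickRate_nonneg (u : I) : 0 ≤ pickRate u :=
  div_nonneg u.2.1 (sub_nonneg.2 u.2.2)

lemma measurable_pickRate : Measurable pickRate := by
  unfold pickRate
  fun_prop

/-- The endpoint kernels are `1` and `x`; in the interior, with `t = u / (1 - u)`, the kernel is `(1
+ t) x / (x + t)`. At both endpoints `pickRate` is `0` (at `1` through division by zero), which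
kills the last term. -/
lemma pickKernel_eq_add {x : ℝ} (hx : 0 < x) (u : I) :
    x / ((1 - (u : ℝ)) * x + u) = (({0} : Set I).indicator (fun _ => 1) u +
      ({1} : Set I).indicator (fun _ => x) u) + (1 + pickRate u) * pickRate u *
        (1 / pickRate u - 1 / (x + pickRate u)) := by
  have h0 := u.2.1
  have h1 := u.2.2
  by_cases hu0 : u = 0
  · subst hu0
    simp [pickRate, hx.ne']
  by_cases hu1 : u = 1
  · subst hu1
    simp [pickRate]
  have h0' : 0 < (u : ℝ) := lt_of_le_of_ne h0 fun h => hu0 (Subtype.ext h.symm)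
  have h1' : 0 < 1 - (u : ℝ) :=
    sub_pos.2 (lt_of_le_of_ne h1 fun h => hu1 (Subtype.ext h))
  have hd : 0 < x * (1 - (u : ℝ)) + u := by positivity
  have hd' : 0 < (1 - (u : ℝ)) * x + u := by positivity
  have e : x + (u : ℝ) / (1 - u) = (x * (1 - u) + u) / (1 - u) := by field_simp
  simp only [mem_singleton_iff, hu0, hu1, not_false_eq_true, indicator_of_notMem, pickRate, e]
  field_simp
  ring

lemma integrable_indicator_singleton (ρ : Measure I) [IsFiniteMeasure ρ] (v : I) (c : ℝ) :
    Integrable (({v} : Set I).indicator fun _ => c) ρ :=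
  (integrable_const c).indicator (measurableSet_singleton v)

/-- Each of the factors `1 + t` and `t` is absorbed by one half of the exponential. -/
lemma one_add_mul_exp_neg_le {s t : ℝ} (hs : 0 < s) (ht : 0 ≤ t) :
    (1 + t) * t * Real.exp (-(s * t)) ≤ (1 + 2 / s) * (2 / s) := by
  have h1 : s * t / 2 + 1 ≤ Real.exp (s * t / 2) := Real.add_one_le_exp _
  have h2 : Real.exp (s * t / 2) * Real.exp (-(s * t / 2)) = 1 := by
    rw [← Real.exp_add]; simp
  have h3 : Real.exp (-(s * t)) = Real.exp (-(s * t / 2)) * Real.exp (-(s * t / 2)) := by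
    rw [← Real.exp_add]; congr 1; ring
  have hE := Real.exp_pos (-(s * t / 2))
  have hE1 : Real.exp (-(s * t / 2)) ≤ 1 := Real.exp_le_one_iff.2 (by
    have := mul_nonneg hs.le ht; linarith)
  have h4 : t * Real.exp (-(s * t / 2)) ≤ 2 / s := by
    rw [le_div_iff₀ hs]
    nlinarith
  have h5 : (1 + t) * Real.exp (-(s * t / 2)) ≤ 1 + 2 / s := by linarith
  rw [h3]
  calc (1 + t) * t * (Real.exp (-(s * t / 2)) * Real.exp (-(s * t / 2)))
      = ((1 + t) * Real.exp (-(s * t / 2))) * (t * Real.exp (-(s * t / 2))) := by ring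
    _ ≤ (1 + 2 / s) * (2 / s) := mul_le_mul h5 h4 (by positivity) (by positivity)

lemma integrableOn_one_sub_exp_mul_exp {x t : ℝ} (hx : 0 < x) (ht : 0 < t) :
    IntegrableOn (fun s : ℝ => (1 - Real.exp (-(x * s))) * Real.exp (-(s * t))) (Ioi 0) ∧
    ∫ s in Ioi (0 : ℝ), (1 - Real.exp (-(x * s))) * Real.exp (-(s * t)) =
      1 / t - 1 / (x + t) := by
  have e : ∀ s : ℝ, (1 - Real.exp (-(x * s))) * Real.exp (-(s * t)) =
      Real.exp (-t * s) - Real.exp (-(x + t) * s) := fun s => by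
    rw [sub_mul, one_mul, ← Real.exp_add]
    ring_nf
  simp_rw [e]
  have i1 := exp_neg_integrableOn_Ioi 0 ht
  have i2 := exp_neg_integrableOn_Ioi 0 (add_pos hx ht)
  refine ⟨i1.sub i2, ?_⟩
  rw [integral_sub i1 i2, integral_exp_mul_Ioi (by linarith), integral_exp_mul_Ioi (by linarith)]
  simp only [mul_zero, Real.exp_zero]
  rw [neg_div_neg_eq, neg_div_neg_eq]

/-- The Lévy density of a superposition of the kernels. -/
noncomputable def pickDensity (ρ : Measure I) (s : ℝ) : ℝ :=
  ∫ u, (1 + pickRate u) * pickRate u * Real.exp (-(s * pickRate u)) ∂ρ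

lemma integrable_pickDensity (ρ : Measure I) [IsFiniteMeasure ρ] {s : ℝ} (hs : 0 < s) :
    Integrable (fun u => (1 + pickRate u) * pickRate u * Real.exp (-(s * pickRate u))) ρ := by
  have := measurable_pickRate
  refine Integrable.of_bound (C := (1 + 2 / s) * (2 / s)) (by fun_prop)
    (Eventually.of_forall fun u => ?_)
  have h0 := pickRate_nonneg u
  rw [Real.norm_of_nonneg (by positivity)]
  exact one_add_mul_exp_neg_le hs h0

lemma pickDensity_nonneg (ρ : Measure I) (s : ℝ) : 0 ≤ pickDensity ρ s :=
  integral_nonneg fun u => by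
    have h0 := pickRate_nonneg u
    positivity

/-- The density is the moment generating function of `-pickRate` under a weighted measure: it is
analytic where the exponentials are integrable, and each derivative brings down a factor `-pickRate
u`. -/
lemma isCompletelyMonotone_pickDensity (ρ : Measure I) [IsFiniteMeasure ρ] :
    IsCompletelyMonotone (pickDensity ρ) := by
  have hm := measurable_pickRate
  let w : I → ℝ≥0 := fun u => ((1 + pickRate u) * pickRate u).toNNReal
  have hw : Measurable w := by fun_prop
  have hwc : ∀ u, (w u : ℝ) = (1 + pickRate u) * pickRate u := fun u =>
    Real.coe_toNNReal _ (by have h0 := pickRate_nonneg u; positivity)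
  let ν := ρ.withDensity fun u => w u
  let X : I → ℝ := fun u => -pickRate u
  have hmgf : pickDensity ρ = ProbabilityTheory.mgf X ν := by
    funext s
    rw [ProbabilityTheory.mgf, integral_withDensity_eq_integral_smul hw]
    simp only [pickDensity, NNReal.smul_def, hwc, X, smul_eq_mul, mul_neg]
  have hset : Ioi 0 ⊆ interior (ProbabilityTheory.integrableExpSet X ν) := by
    refine interior_maximal (fun s hs => ?_) isOpen_Ioi
    change Integrable (fun u => Real.exp (s * X u)) ν
    rw [integrable_withDensity_iff_integrable_coe_smul hw]
    simpa only [hwc, X, smul_eq_mul, mul_neg] using integrable_pickDensity ρ hs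
  constructor
  · rw [hmgf]
    exact ((ProbabilityTheory.analyticOnNhd_mgf (X := X) (μ := ν)).mono hset).contDiffOn
      (uniqueDiffOn_Ioi 0)
  · intro n s hs
    rw [hmgf, ProbabilityTheory.iteratedDeriv_mgf (hset hs), ← integral_const_mul]
    refine integral_nonneg fun u => ?_
    have h0 := pickRate_nonneg u
    have : (-1 : ℝ) ^ n * (X u ^ n * Real.exp (s * X u)) =
        pickRate u ^ n * Real.exp (s * X u) := by
      rw [← mul_assoc, ← mul_pow]; simp [X]
    simp only [this, Pi.zero_apply]
    positivity

lemma integrable_one_sub_exp_mul_pickDensity_prod (ρ : Measure I) [IsFiniteMeasure ρ] {x : ℝ}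
    (hx : 0 < x) :
    Integrable (Function.uncurry fun (s : ℝ) (u : I) => (1 - Real.exp (-(x * s))) *
      ((1 + pickRate u) * pickRate u * Real.exp (-(s * pickRate u))))
      ((volume.restrict (Ioi 0)).prod ρ) ∧
    (∫ u, (1 + pickRate u) * pickRate u * (1 / pickRate u - 1 / (x + pickRate u)) ∂ρ =
      ∫ u, (∫ s in Ioi (0 : ℝ), (1 - Real.exp (-(x * s))) *
      ((1 + pickRate u) * pickRate u * Real.exp (-(s * pickRate u)))) ∂ρ) := by
  have hm := measurable_pickRate
  have key : ∀ u, IntegrableOn (fun s => (1 - Real.exp (-(x * s))) *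
      ((1 + pickRate u) * pickRate u * Real.exp (-(s * pickRate u)))) (Ioi 0) ∧
      ∫ s in Ioi (0 : ℝ), (1 - Real.exp (-(x * s))) *
      ((1 + pickRate u) * pickRate u * Real.exp (-(s * pickRate u))) =
      (1 + pickRate u) * pickRate u * (1 / pickRate u - 1 / (x + pickRate u)) := by
    intro u
    rcases (pickRate_nonneg u).eq_or_lt with h | h
    · simp [← h, IntegrableOn]
    · obtain ⟨i, e⟩ := integrableOn_one_sub_exp_mul_exp hx h
      have : ∀ s, (1 - Real.exp (-(x * s))) *
          ((1 + pickRate u) * pickRate u * Real.exp (-(s * pickRate u))) =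
          (1 + pickRate u) * pickRate u *
          ((1 - Real.exp (-(x * s))) * Real.exp (-(s * pickRate u))) := fun s => by ring
      simp_rw [this]
      exact ⟨i.const_mul _, by rw [integral_const_mul, e]⟩
  refine ⟨?_, integral_congr_ae (Eventually.of_forall fun u => (key u).2.symm)⟩
  rw [integrable_prod_iff' (by
    refine Measurable.aestronglyMeasurable ?_
    simp only [Function.uncurry_def]
    fun_prop)]
  refine ⟨Eventually.of_forall fun u => (key u).1, ?_⟩
  -- The integrand is nonnegative, so the inner norm integral is the kernel minus its endpoint part,
  -- which is integrable because the measure is finite.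
  have hnorm : ∀ u, ∫ s in Ioi (0 : ℝ), ‖Function.uncurry (fun (s : ℝ) (u : I) =>
      (1 - Real.exp (-(x * s))) *
      ((1 + pickRate u) * pickRate u * Real.exp (-(s * pickRate u)))) (s, u)‖ =
      x / ((1 - (u : ℝ)) * x + u) - (({0} : Set I).indicator (fun _ => (1 : ℝ)) u +
      ({1} : Set I).indicator (fun _ => x) u) := by
    intro u
    rw [pickKernel_eq_add hx u, add_sub_cancel_left, ← (key u).2]
    refine setIntegral_congr_fun measurableSet_Ioi fun s hs => ?_
    have h0 := pickRate_nonneg u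
    have : 0 ≤ 1 - Real.exp (-(x * s)) := sub_nonneg.2 (Real.exp_le_one_iff.2 (by
      have := mul_pos hx (mem_Ioi.1 hs); linarith))
    exact Real.norm_of_nonneg (by simp only [Function.uncurry]; positivity)
  simp_rw [hnorm]
  exact (integrable_pickKernel_real hx ρ).sub
    ((integrable_indicator_singleton ρ 0 1).add (integrable_indicator_singleton ρ 1 x))

lemma min_le_two_mul_one_sub_exp {s : ℝ} (hs : 0 < s) : min 1 s ≤ 2 * (1 - Real.exp (-s)) := by
  have h1 : Real.exp (-s) * Real.exp s = 1 := by rw [← Real.exp_add]; simp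
  have h2 := Real.add_one_le_exp s
  have h3 := Real.exp_pos (-s)
  have h4 : Real.exp (-s) * (s + 1) ≤ 1 := by nlinarith
  have h5 : Real.exp (-s) ≤ 1 / (s + 1) := by rwa [le_div_iff₀ (by linarith)]
  have h6 : min 1 s ≤ 2 * (1 - 1 / (s + 1)) := by
    have e : 1 - 1 / (s + 1) = s / (s + 1) := by field_simp; ring
    rw [e, mul_div_assoc', le_div_iff₀ (by linarith)]
    rcases le_total 1 s with h | h
    · rw [min_eq_left h]; linarith
    · rw [min_eq_right h]; nlinarith
  linarith

/-- The atoms of the measure at `0` and `1` are the constants `c₁` and `c₂`; the rest becomes the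
Lévy integral by Fubini. Integrability of `min 1 s * m s` follows from the case `x = 1`. -/
theorem IsPick.isCompleteBernstein {f : ℝ → ℝ} (hf : IsPick f) : IsCompleteBernstein f := by
  obtain ⟨ρ, hρ⟩ := hf
  set μ : Measure I := (ρ : Measure I) with hμ
  have hint : ∀ x : ℝ, 0 < x →
      IntegrableOn (fun s => (1 - Real.exp (-(x * s))) * pickDensity μ s) (Ioi 0) := fun x hx => by
    have := (integrable_one_sub_exp_mul_pickDensity_prod μ hx).1.integral_prod_left
    simp only [Function.uncurry_apply_pair, integral_const_mul] at this
    exact this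
  refine ⟨μ.real {0}, μ.real {1}, pickDensity μ, measureReal_nonneg, measureReal_nonneg,
    isCompletelyMonotone_pickDensity μ, ?_, fun x hx => ?_⟩
  · have hc := (isCompletelyMonotone_pickDensity μ).contDiffOn.continuousOn
    refine Integrable.mono' ((hint 1 one_pos).const_mul 2)
      (ContinuousOn.aestronglyMeasurable (ContinuousOn.mul (by fun_prop) hc) measurableSet_Ioi) ?_
    filter_upwards [ae_restrict_mem measurableSet_Ioi] with s hs
    have hs' : 0 < s := hs
    have h0 := pickDensity_nonneg μ s
    have h1 : 0 ≤ min 1 s := le_min zero_le_one hs'.le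
    rw [Real.norm_of_nonneg (by positivity), ← mul_assoc, one_mul]
    exact mul_le_mul_of_nonneg_right (min_le_two_mul_one_sub_exp hs') h0
  · have hx' := hρ x hx
    rw [pickTransform_ofReal, Complex.ofReal_inj] at hx'
    obtain ⟨hprod, e⟩ := integrable_one_sub_exp_mul_pickDensity_prod μ hx
    rw [hx']
    have i0 := integrable_indicator_singleton μ 0 1
    have i1 := integrable_indicator_singleton μ 1 x
    have i01 : Integrable (fun u => ({0} : Set I).indicator (fun _ => (1 : ℝ)) u +
        ({1} : Set I).indicator (fun _ => x) u) μ := i0.add i1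
    have ik := (integrable_pickKernel_real hx μ).sub i01
    have i2 : Integrable (fun u => (1 + pickRate u) * pickRate u *
        (1 / pickRate u - 1 / (x + pickRate u))) μ := by
      refine ik.congr (Eventually.of_forall fun u => ?_)
      simp only [Pi.sub_apply]
      rw [pickKernel_eq_add hx u, add_sub_cancel_left]
    simp_rw [pickKernel_eq_add hx]
    rw [integral_add i01 i2, integral_add i0 i1, e, ← integral_integral_swap hprod,
      integral_indicator_const _ (measurableSet_singleton _),
      integral_indicator_const _ (measurableSet_singleton _)]
    simp only [smul_eq_mul, mul_one, integral_const_mul]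
    rfl

/-! ### Taylor series of completely monotone functions -/

namespace IsCompletelyMonotone

variable {m : ℝ → ℝ}

lemma contDiffAt (hm : IsCompletelyMonotone m) {s : ℝ} (hs : 0 < s) :
    ContDiffAt ℝ ((⊤ : ℕ∞) : WithTop ℕ∞) m s :=
  hm.contDiffOn.contDiffAt (Ioi_mem_nhds hs)

lemma apply_nonneg (hm : IsCompletelyMonotone m) {s : ℝ} (hs : 0 < s) : 0 ≤ m s := by
  simpa using hm.nonneg 0 s hs

/-- The terms of the Taylor series at `b`, evaluated at `x`. -/
noncomputable def taylorTerm (m : ℝ → ℝ) (b x : ℝ) (k : ℕ) : ℝ :=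
  (-1) ^ k * iteratedDeriv k m b / (k.factorial : ℝ) * (b - x) ^ k

lemma taylorTerm_nonneg (hm : IsCompletelyMonotone m) {b x : ℝ} (hb : 0 < b) (hxb : x ≤ b)
    (k : ℕ) : 0 ≤ taylorTerm m b x k :=
  mul_nonneg (div_nonneg (hm.nonneg k b hb) (by positivity)) (pow_nonneg (sub_nonneg.2 hxb) k)

lemma iteratedDerivWithin_uIcc (hm : IsCompletelyMonotone m) {b x y : ℝ} (hx : 0 < x)
    (hxb : x < b) (hy : y ∈ uIcc b x) (k : ℕ) :
    iteratedDerivWithin k m (uIcc b x) y = iteratedDeriv k m y := by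
  refine iteratedDerivWithin_eq_iteratedDeriv (uniqueDiffOn_uIcc hxb.ne') ?_ hy
  rw [uIcc_of_ge hxb.le] at hy
  exact (hm.contDiffAt (hx.trans_le hy.1)).of_le (by exact_mod_cast le_top)

lemma contDiffOn_uIcc (hm : IsCompletelyMonotone m) {b x : ℝ} (hx : 0 < x)
    (hxb : x < b) (n : ℕ) : ContDiffOn ℝ n m (uIcc b x) := by
  refine (hm.contDiffOn.mono fun y hy => ?_).of_le (by exact_mod_cast le_top)
  rw [uIcc_of_ge hxb.le] at hy
  exact hx.trans_le hy.1

lemma taylorWithinEval_eq (hm : IsCompletelyMonotone m) {b x : ℝ} (hx : 0 < x) (hxb : x < b)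
    (n : ℕ) :
    taylorWithinEval m n (uIcc b x) b x = ∑ k ∈ Finset.range (n + 1), taylorTerm m b x k := by
  rw [taylor_within_apply]
  refine Finset.sum_congr rfl fun k _ => ?_
  rw [hm.iteratedDerivWithin_uIcc hx hxb left_mem_uIcc, taylorTerm, smul_eq_mul,
    show x - b = (-1) * (b - x) by ring, mul_pow]
  ring

lemma differentiableOn_iteratedDerivWithin (hm : IsCompletelyMonotone m) {b x : ℝ} (hx : 0 < x)
    (hxb : x < b) (n : ℕ) :
    DifferentiableOn ℝ (iteratedDerivWithin n m (uIcc b x)) (uIoo b x) :=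
  ((hm.contDiffOn_uIcc hx hxb (n + 1)).differentiableOn_iteratedDerivWithin
    (by exact_mod_cast n.lt_succ_self) (uniqueDiffOn_uIcc hxb.ne')).mono uIoo_subset_uIcc_self

/-- In the Lagrange remainder, the signs of the derivative of order `n + 1` and of `(x - b) ^ (n +
1)` cancel. -/
lemma sum_taylorTerm_le (hm : IsCompletelyMonotone m) {b x : ℝ} (hx : 0 < x) (hxb : x < b)
    (n : ℕ) : ∑ k ∈ Finset.range (n + 1), taylorTerm m b x k ≤ m x := by
  obtain ⟨y, hy, h⟩ := taylor_mean_remainder_lagrange hxb.ne' (hm.contDiffOn_uIcc hx hxb n)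
    (hm.differentiableOn_iteratedDerivWithin hx hxb n)
  rw [hm.taylorWithinEval_eq hx hxb,
    hm.iteratedDerivWithin_uIcc hx hxb (uIoo_subset_uIcc_self hy)] at h
  rw [uIoo_of_ge hxb.le] at hy
  have h1 := hm.nonneg (n + 1) y (hx.trans hy.1)
  have h2 : 0 ≤ iteratedDeriv (n + 1) m y * (x - b) ^ (n + 1) / ((n + 1).factorial : ℝ) := by
    rw [show x - b = (-1) * (b - x) by ring, mul_pow, ← mul_assoc, mul_comm (iteratedDeriv _ _ _)]
    exact div_nonneg (mul_nonneg h1 (pow_nonneg (by linarith) _)) (by positivity)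
  linarith

lemma taylorTerm_le (hm : IsCompletelyMonotone m) {b x : ℝ} (hx : 0 < x) (hxb : x < b)
    (n : ℕ) : taylorTerm m b x n ≤ m x :=
  (Finset.single_le_sum (fun k _ => hm.taylorTerm_nonneg (hx.trans hxb) hxb.le k)
    (Finset.self_mem_range_succ n)).trans (hm.sum_taylorTerm_le hx hxb n)

/-- The Cauchy form of the remainder has `(y - x) ^ n`, which vanishes as `y → x` and beats the
bound on the derivative at `y`. This gives a geometric rate uniform in the unknown `y`. -/
lemma sub_sum_taylorTerm_le (hm : IsCompletelyMonotone m) {b x : ℝ} (hx : 0 < x) (hxb : x < b)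
    (n : ℕ) : m x - ∑ k ∈ Finset.range (n + 1), taylorTerm m b x k ≤
      m (x / 2) * ((b - x) / (x / 2)) * ((n + 1) * ((b - x) / (b - x / 2)) ^ n) := by
  obtain ⟨y, hy, h⟩ := taylor_mean_remainder_cauchy hxb.ne' (hm.contDiffOn_uIcc hx hxb n)
    (hm.differentiableOn_iteratedDerivWithin hx hxb n)
  rw [hm.taylorWithinEval_eq hx hxb,
    hm.iteratedDerivWithin_uIcc hx hxb (uIoo_subset_uIcc_self hy)] at h
  rw [uIoo_of_ge hxb.le] at hy
  obtain ⟨hxy, hyb⟩ := hy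
  have hy0 : 0 < y := hx.trans hxy
  have hd : 0 < y - x / 2 := by linarith
  have hm0 := hm.apply_nonneg (half_pos hx)
  -- A Cauchy-type estimate: one term of the expansion about `y`, evaluated at `x / 2`, is at most
  -- `m (x / 2)`.
  have h1 := hm.taylorTerm_le (half_pos hx) (by linarith : x / 2 < y) (n + 1)
  rw [taylorTerm] at h1
  set A := (-1) ^ (n + 1) * iteratedDeriv (n + 1) m y with hA
  have hA0 : 0 ≤ A := hm.nonneg (n + 1) y hy0
  have hf : (0 : ℝ) < (n.factorial : ℝ) := by positivity
  have h2 : A / (n.factorial : ℝ) ≤ m (x / 2) * (n + 1) / (y - x / 2) ^ (n + 1) := by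
    rw [Nat.factorial_succ, div_mul_eq_mul_div, div_le_iff₀ (by positivity)] at h1
    push_cast at h1
    rw [div_le_div_iff₀ hf (by positivity)]
    linarith
  have h3 : iteratedDeriv (n + 1) m y * (x - y) ^ n / (n.factorial : ℝ) * (x - b) =
      A / (n.factorial : ℝ) * ((y - x) ^ n * (b - x)) := by
    rw [hA, show x - y = (-1) * (y - x) by ring, mul_pow]
    ring
  rw [h, h3]
  -- The quotient increases with `y`, so its value at `b` bounds it.
  have hq : (y - x) / (y - x / 2) ≤ (b - x) / (b - x / 2) := by
    rw [div_le_div_iff₀ hd (by linarith)]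
    nlinarith
  have hq' : 1 / (y - x / 2) ≤ 1 / (x / 2) :=
    one_div_le_one_div_of_le (by linarith) (by linarith)
  have hbx : 0 ≤ b - x := by linarith
  have hyx : 0 ≤ y - x := by linarith
  calc A / (n.factorial : ℝ) * ((y - x) ^ n * (b - x))
      ≤ m (x / 2) * (n + 1) / (y - x / 2) ^ (n + 1) * ((y - x) ^ n * (b - x)) := by gcongr
    _ = m (x / 2) * (n + 1) * ((b - x) * ((1 / (y - x / 2)) * ((y - x) / (y - x / 2)) ^ n)) := by
        rw [div_pow, pow_succ]; field_simp
    _ ≤ m (x / 2) * (n + 1) * ((b - x) * ((1 / (x / 2)) * ((b - x) / (b - x / 2)) ^ n)) := by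
        have : 0 ≤ (y - x) / (y - x / 2) := div_nonneg hyx hd.le
        gcongr
    _ = _ := by ring

theorem hasSum_taylorTerm (hm : IsCompletelyMonotone m) {b x : ℝ} (hx : 0 < x) (hxb : x < b) :
    HasSum (taylorTerm m b x) (m x) := by
  rw [hasSum_iff_tendsto_nat_of_nonneg (hm.taylorTerm_nonneg (hx.trans hxb) hxb.le),
    ← tendsto_add_atTop_iff_nat 1]
  have hr0 : 0 ≤ (b - x) / (b - x / 2) := div_nonneg (by linarith) (by linarith)
  have hr1 : (b - x) / (b - x / 2) < 1 := by
    rw [div_lt_one (by linarith)]; linarith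
  have hlim : Tendsto (fun n : ℕ => m (x / 2) * ((b - x) / (x / 2)) *
      (((n : ℝ) + 1) * ((b - x) / (b - x / 2)) ^ n)) atTop (𝓝 0) := by
    have h1 := tendsto_self_mul_const_pow_of_lt_one hr0 hr1
    have h2 := tendsto_pow_atTop_nhds_zero_of_lt_one hr0 hr1
    have h3 := (h1.add h2).const_mul (m (x / 2) * ((b - x) / (x / 2)))
    simpa only [add_mul, one_mul, add_zero, mul_zero] using h3
  have h4 : Tendsto (fun n : ℕ => m x - ∑ k ∈ Finset.range (n + 1), taylorTerm m b x k) atTop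
      (𝓝 0) := squeeze_zero (fun n => sub_nonneg.2 (hm.sum_taylorTerm_le hx hxb n))
    (fun n => hm.sub_sum_taylorTerm_le hx hxb n) hlim
  simpa using h4.const_sub (m x)

end IsCompletelyMonotone

/-! ### Complete Bernstein functions are superpositions of the kernels -/

lemma one_sub_rpow_bounds {t p : ℝ} (ht : 0 ≤ t) (ht1 : t ≤ 1) (hp : 0 < p) :
    0 ≤ 1 - (1 - t) ^ p ∧ 1 - (1 - t) ^ p ≤ 1 ∧ 1 - (1 - t) ^ p ≤ max 1 p * t := by
  have h0 : 0 ≤ 1 - t := by linarith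
  refine ⟨sub_nonneg.2 (Real.rpow_le_one h0 (by linarith) hp.le), ?_, ?_⟩
  · have := Real.rpow_nonneg h0 p
    linarith
  · rcases le_total 1 p with h | h
    · rw [max_eq_right h]
      have := one_add_mul_self_le_rpow_one_add (s := -t) (by linarith) h
      rw [← sub_eq_add_neg] at this
      linarith
    · rw [max_eq_left h]
      rcases eq_or_lt_of_le h0 with h0' | h0'
      · rw [← h0', Real.zero_rpow hp.ne']; linarith
      · have := Real.rpow_le_rpow_of_exponent_ge h0' (by linarith) h
        rw [Real.rpow_one] at this
        linarith

/-- The bound does not depend on `b`, so it serves as the dominating function both for fixed `b` and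
as `b → ∞`. -/
lemma one_sub_rpow_le_min {b s x : ℝ} (hb : 1 ≤ b) (hs : 0 < s) (hsb : s < b) (hx : 0 < x) :
    0 ≤ 1 - (1 - s / b) ^ (b * x) ∧
      1 - (1 - s / b) ^ (b * x) ≤ max 1 x * min 1 s := by
  have hb0 : 0 < b := by linarith
  obtain ⟨h0, h1, h2⟩ := one_sub_rpow_bounds (t := s / b) (p := b * x) (by positivity)
    ((div_le_one hb0).2 hsb.le) (by positivity)
  refine ⟨h0, ?_⟩
  rcases le_total 1 s with h | h
  · rw [min_eq_left h, mul_one]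
    exact h1.trans (le_max_left _ _)
  · rw [min_eq_right h]
    refine h2.trans ?_
    rw [mul_div_assoc', div_le_iff₀ hb0]
    have : max 1 (b * x) ≤ max 1 x * b := by
      refine max_le ?_ ?_
      · have := le_max_left 1 x
        nlinarith
      · have := le_max_right 1 x
        nlinarith
    nlinarith

lemma integral_one_sub_rpow_mul_pow {b p : ℝ} (hb : 0 < b) (hp : 0 < p) (k : ℕ) :
    ∫ s in Ioo 0 b, (1 - (1 - s / b) ^ p) * (1 - s / b) ^ k =
      b * (1 / (k + 1) - 1 / (k + 1 + p)) := by
  rw [← integral_Ioc_eq_integral_Ioo, ← intervalIntegral.integral_of_le hb.le]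
  rw [intervalIntegral.integral_comp_sub_div (fun y => (1 - y ^ p) * y ^ k) hb.ne' 1]
  have e : ∫ y in (0 : ℝ)..1, (1 - y ^ p) * y ^ k = ∫ y in (0 : ℝ)..1, (y ^ k - y ^ (k + p)) := by
    refine intervalIntegral.integral_congr_ae (Eventually.of_forall fun y hy => ?_)
    rw [uIoc_of_le zero_le_one] at hy
    rw [Real.rpow_add hy.1, Real.rpow_natCast]
    ring
  have hk : (0 : ℝ) ≤ k := Nat.cast_nonneg k
  rw [div_self hb.ne', zero_div, sub_self, sub_zero, e, smul_eq_mul,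
    intervalIntegral.integral_sub (by simp)
      (intervalIntegral.intervalIntegrable_rpow' (by linarith)), integral_pow,
    integral_rpow (Or.inl (by linarith)), Real.zero_rpow (by positivity), Real.one_rpow]
  simp only [one_pow, ne_eq, Nat.add_eq_zero_iff, one_ne_zero, and_false, not_false_eq_true,
    zero_pow, sub_zero]
  ring_nf

namespace IsCompletelyMonotone

variable {m : ℝ → ℝ}

lemma taylorTerm_eq (b s : ℝ) (hb : 0 < b) (k : ℕ) :
    taylorTerm m b s k = taylorTerm m b 0 k * (1 - s / b) ^ k := by
  have : b - s = b * (1 - s / b) := by field_simp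
  rw [taylorTerm, taylorTerm, this, mul_pow, sub_zero]
  ring

lemma integrableOn_one_sub_rpow_mul (hm : IsCompletelyMonotone m)
    (hint : IntegrableOn (fun s : ℝ => min 1 s * m s) (Ioi 0)) {b x : ℝ} (hb : 1 ≤ b)
    (hx : 0 < x) : IntegrableOn (fun s => (1 - (1 - s / b) ^ (b * x)) * m s) (Ioo 0 b) := by
  have hb0 : 0 < b := by linarith
  refine Integrable.mono' ((hint.mono_set Ioo_subset_Ioi_self).const_mul (max 1 x)) ?_ ?_
  · refine ContinuousOn.aestronglyMeasurable (ContinuousOn.mul ?_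
      (hm.contDiffOn.continuousOn.mono Ioo_subset_Ioi_self)) measurableSet_Ioo
    exact (continuous_const.sub ((continuous_const.sub (continuous_id.div_const b)).rpow_const
      fun _ => Or.inr (by positivity))).continuousOn
  · filter_upwards [ae_restrict_mem measurableSet_Ioo] with s hs
    obtain ⟨h0, h1⟩ := one_sub_rpow_le_min hb hs.1 hs.2 hx
    have hm0 := hm.apply_nonneg hs.1
    rw [Real.norm_of_nonneg (mul_nonneg h0 hm0), ← mul_assoc]
    exact mul_le_mul_of_nonneg_right h1 hm0

/-- Expand `m` about `b` and integrate termwise: `b (1 / (k + 1) - 1 / (k + 1 + b x))` equals `(b /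
(k + 1)) · x / (x + (k + 1) / b)`, a positive multiple of a kernel. Partial sums stay below `m`, so
dominated convergence applies. -/
lemma isPick_integral_one_sub_rpow (hm : IsCompletelyMonotone m)
    (hint : IntegrableOn (fun s : ℝ => min 1 s * m s) (Ioi 0)) {b : ℝ} (hb : 1 ≤ b) :
    IsPick fun x => ∫ s in Ioo 0 b, (1 - (1 - s / b) ^ (b * x)) * m s := by
  have hb0 : 0 < b := by linarith
  have ha : ∀ k, 0 ≤ taylorTerm m b 0 k := hm.taylorTerm_nonneg hb0 hb0.le
  refine IsPick.of_tendsto (fs := fun N x => ∑ k ∈ Finset.range (N + 1),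
    (taylorTerm m b 0 k * b / (k + 1)) * (x / (x + (k + 1) / b))) (fun N => ?_) fun x hx => ?_
  · refine IsPick.sum _ fun k _ => IsPick.div_add ?_ (by positivity)
    have := ha k
    positivity
  have hp : 0 < b * x := by positivity
  have hcont : ∀ k : ℕ, Continuous fun s : ℝ => (1 - (1 - s / b) ^ (b * x)) * (1 - s / b) ^ k :=
    fun k => (continuous_const.sub ((continuous_const.sub
      (continuous_id.div_const b)).rpow_const fun _ => Or.inr hp.le)).mul (by fun_prop)
  have hsum : ∀ N : ℕ, ∑ k ∈ Finset.range (N + 1),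
      (taylorTerm m b 0 k * b / (k + 1)) * (x / (x + (k + 1) / b)) =
      ∫ s in Ioo 0 b, (1 - (1 - s / b) ^ (b * x)) *
        ∑ k ∈ Finset.range (N + 1), taylorTerm m b s k := by
    intro N
    have e : ∀ s, (1 - (1 - s / b) ^ (b * x)) * ∑ k ∈ Finset.range (N + 1), taylorTerm m b s k =
        ∑ k ∈ Finset.range (N + 1), taylorTerm m b 0 k *
          ((1 - (1 - s / b) ^ (b * x)) * (1 - s / b) ^ k) := fun s => by
      rw [Finset.mul_sum]
      refine Finset.sum_congr rfl fun k _ => ?_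
      rw [taylorTerm_eq b s hb0]
      ring
    simp_rw [e]
    rw [integral_finsetSum _ fun k _ => (((hcont k).integrableOn_Icc (a := 0) (b := b)).mono_set
      Ioo_subset_Icc_self).const_mul _]
    refine Finset.sum_congr rfl fun k _ => ?_
    rw [integral_const_mul, integral_one_sub_rpow_mul_pow hb0 hp]
    field_simp
    ring
  simp_rw [hsum]
  refine tendsto_integral_of_dominated_convergence
    (fun s => (1 - (1 - s / b) ^ (b * x)) * m s) (fun N => ?_)
    (hm.integrableOn_one_sub_rpow_mul hint hb hx) (fun N => ?_) ?_
  · refine Continuous.aestronglyMeasurable ?_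
    refine Continuous.mul (by simpa using hcont 0) ?_
    unfold taylorTerm
    fun_prop
  · filter_upwards [ae_restrict_mem measurableSet_Ioo] with s hs
    obtain ⟨h0, -⟩ := one_sub_rpow_le_min hb hs.1 hs.2 hx
    rw [Real.norm_of_nonneg (mul_nonneg h0
      (Finset.sum_nonneg fun k _ => hm.taylorTerm_nonneg hb0 hs.2.le k))]
    exact mul_le_mul_of_nonneg_left (hm.sum_taylorTerm_le hs.1 hs.2 N) h0
  · filter_upwards [ae_restrict_mem measurableSet_Ioo] with s hs
    exact (((hm.hasSum_taylorTerm hs.1 hs.2).tendsto_sum_nat.comp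
      (tendsto_add_atTop_nat 1))).const_mul _

lemma tendsto_one_sub_div_rpow {s x : ℝ} (hx : 0 < x) :
    Tendsto (fun n : ℕ => (1 - s / ((n : ℝ) + 1)) ^ (((n : ℝ) + 1) * x)) atTop
      (𝓝 (Real.exp (-(x * s)))) := by
  have hn : Tendsto (fun n : ℕ => (n : ℝ) + 1) atTop atTop :=
    tendsto_atTop_add_const_right _ _ tendsto_natCast_atTop_atTop
  have h1 := ((Real.tendsto_one_add_div_rpow_exp (-s)).comp hn).rpow_const
    (p := x) (Or.inr hx.le)
  rw [← Real.exp_mul] at h1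
  rw [show -(x * s) = -s * x by ring]
  refine h1.congr' ?_
  filter_upwards [hn.eventually_ge_atTop |s|, hn.eventually_gt_atTop 0] with n h2 h3
  have h4 : 0 ≤ 1 - s / ((n : ℝ) + 1) :=
    sub_nonneg.2 ((div_le_one h3).2 ((le_abs_self s).trans h2))
  rw [Real.rpow_mul h4, Function.comp_apply, neg_div, ← sub_eq_add_neg]

lemma isPick_integral (hm : IsCompletelyMonotone m)
    (hint : IntegrableOn (fun s : ℝ => min 1 s * m s) (Ioi 0)) :
    IsPick fun x => ∫ s in Ioi 0, (1 - Real.exp (-(x * s))) * m s := by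
  refine IsPick.of_tendsto (fun n : ℕ => hm.isPick_integral_one_sub_rpow hint
    (b := (n : ℝ) + 1) (by have := n.cast_nonneg (α := ℝ); linarith)) fun x hx => ?_
  have e : ∀ n : ℕ, ∫ s in Ioo 0 ((n : ℝ) + 1),
      (1 - (1 - s / ((n : ℝ) + 1)) ^ (((n : ℝ) + 1) * x)) * m s =
      ∫ s in Ioi 0, (Iio ((n : ℝ) + 1)).indicator
        (fun s => (1 - (1 - s / ((n : ℝ) + 1)) ^ (((n : ℝ) + 1) * x)) * m s) s := fun n => by
    rw [setIntegral_indicator measurableSet_Iio, Ioi_inter_Iio]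
  simp_rw [e]
  refine tendsto_integral_of_dominated_convergence (fun s => max 1 x * (min 1 s * m s))
    (fun n => ?_) (hint.const_mul _) (fun n => ?_) ?_
  · refine AEStronglyMeasurable.indicator (ContinuousOn.aestronglyMeasurable (ContinuousOn.mul ?_
      hm.contDiffOn.continuousOn) measurableSet_Ioi) measurableSet_Iio
    exact (continuous_const.sub ((continuous_const.sub
      (continuous_id.div_const _)).rpow_const fun _ => Or.inr (by positivity))).continuousOn
  · filter_upwards [ae_restrict_mem measurableSet_Ioi] with s hs
    have hs' : 0 < s := hs
    have hm0 := hm.apply_nonneg hs'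
    have hmin : 0 ≤ min 1 s := le_min zero_le_one hs'.le
    by_cases hsn : s < (n : ℝ) + 1
    · rw [indicator_of_mem (mem_Iio.2 hsn)]
      obtain ⟨h0, h1⟩ := one_sub_rpow_le_min (b := (n : ℝ) + 1)
        (by have := n.cast_nonneg (α := ℝ); linarith) hs' hsn hx
      rw [Real.norm_of_nonneg (mul_nonneg h0 hm0), ← mul_assoc]
      exact mul_le_mul_of_nonneg_right h1 hm0
    · rw [indicator_of_notMem (by simpa using hsn), norm_zero]
      positivity
  · filter_upwards [ae_restrict_mem measurableSet_Ioi] with s hs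
    refine (((tendsto_one_sub_div_rpow hx).const_sub 1).mul_const (m s)).congr' ?_
    have hn : Tendsto (fun n : ℕ => (n : ℝ) + 1) atTop atTop :=
      tendsto_atTop_add_const_right _ _ tendsto_natCast_atTop_atTop
    filter_upwards [hn.eventually_gt_atTop s] with n hns
    rw [indicator_of_mem (mem_Iio.2 hns)]

end IsCompletelyMonotone

theorem IsCompleteBernstein.isPick {f : ℝ → ℝ} (hf : IsCompleteBernstein f) : IsPick f := by
  obtain ⟨c₁, c₂, m, hc₁, hc₂, hm, hint, h⟩ := hf
  obtain ⟨ρ, hρ⟩ := ((IsPick.const hc₁).add (IsPick.linear hc₂)).add (hm.isPick_integral hint)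
  exact ⟨ρ, fun x hx => by rw [h x hx, ← hρ x hx]⟩

/-! ### Rational functions with interlacing zeros and poles -/

/-- An order-free form of interlacing: each `α j` lies in `(0, s j)`, and `s j` does not separate
`α i` from `s i` for `i ≠ j`. -/
structure Interlaces {ι : Type*} (α s : ι → ℝ) : Prop where
  pos : ∀ j, 0 < α j
  lt : ∀ j, α j < s j
  mul_pos : ∀ i j, i ≠ j → 0 < (α i - s j) * (s i - s j)

namespace Interlaces

variable {ι : Type*} {α s : ι → ℝ}

lemma pos_right (h : Interlaces α s) (j : ι) : 0 < s j := (h.pos j).trans (h.lt j)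

lemma injective_right (h : Interlaces α s) : Function.Injective s := by
  intro i j hij
  by_contra hne
  have := h.mul_pos i j hne
  rw [hij, sub_self, mul_zero] at this
  exact this.false

lemma injective_left (h : Interlaces α s) : Function.Injective α := by
  intro i j hij
  by_contra hne
  have h1 := h.mul_pos i j hne
  have h2 := h.mul_pos j i (Ne.symm hne)
  have h3 := h.lt i
  have h4 := h.lt j
  rw [hij] at h1 h3
  rw [← sub_neg] at h3 h4
  have h5 := neg_of_mul_pos_right h1 h4.le
  have h6 := neg_of_mul_pos_right h2 h3.le
  linarith

lemma sqrt (h : Interlaces α s) : Interlaces (fun i => √(α i)) (fun i => √(s i)) where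
  pos j := Real.sqrt_pos.2 (h.pos j)
  lt j := Real.sqrt_lt_sqrt (h.pos j).le (h.lt j)
  mul_pos i j hij := by
    rcases pos_and_pos_or_neg_and_neg_of_mul_pos (h.mul_pos i j hij) with ⟨h1, h2⟩ | ⟨h1, h2⟩
    · exact _root_.mul_pos
        (sub_pos.2 (Real.sqrt_lt_sqrt (h.pos_right j).le (sub_pos.1 h1)))
        (sub_pos.2 (Real.sqrt_lt_sqrt (h.pos_right j).le (sub_pos.1 h2)))
    · exact mul_pos_of_neg_of_neg
        (sub_neg.2 (Real.sqrt_lt_sqrt (h.pos i).le (sub_neg.1 h1)))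
        (sub_neg.2 (Real.sqrt_lt_sqrt (h.pos_right i).le (sub_neg.1 h2)))

end Interlaces

section PartialFractions

variable {ι F : Type*} [Fintype ι] [Field F]

open Polynomial in
-- Both polynomials are monic of the same degree, so the leading terms cancel.
lemma degree_nodal_sub_nodal_lt (v w : ι → F) :
    (Lagrange.nodal Finset.univ v - Lagrange.nodal Finset.univ w).degree <
      (Finset.univ : Finset ι).card := by
  have hv := Lagrange.degree_nodal (s := Finset.univ) (v := v)
  have hw := Lagrange.degree_nodal (s := Finset.univ) (v := w)
  rw [← hv]
  exact degree_sub_lt_left (hv.trans hw.symm) Lagrange.nodal_monic.ne_zero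
    (by rw [Lagrange.nodal_monic.leadingCoeff, Lagrange.nodal_monic.leadingCoeff])

variable [DecidableEq ι]

/-- The residue at `-s j` of `∏ (z + α i) / (z + s i)`. -/
def interlacingResidue (α s : ι → F) (j : ι) : F :=
  (∏ i, (α i - s j)) * ∏ k ∈ Finset.univ.erase j, (s k - s j)⁻¹

lemma prod_div_eq_one_add_sum (α s : ι → F) (hs : Function.Injective s) {z : F}
    (hz : ∀ i, z + s i ≠ 0) :
    ∏ i, (z + α i) / (z + s i) = 1 + ∑ j, interlacingResidue α s j / (z + s j) := by
  set P := Lagrange.nodal Finset.univ fun i => -α i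
  set Q := Lagrange.nodal Finset.univ fun i => -s i
  have hinj : Set.InjOn (fun i => -s i) (Finset.univ : Finset ι) :=
    (neg_injective.comp hs).injOn
  have hP : ∀ x, P.eval x = ∏ i, (x + α i) := fun x => by simp [P, Lagrange.eval_nodal]
  have hQ : ∀ x, Q.eval x = ∏ i, (x + s i) := fun x => by simp [Q, Lagrange.eval_nodal]
  -- `P - Q` has degree below the number of nodes, so interpolation at the zeros of `Q` recovers it;
  -- dividing by `Q` gives the partial fractions.
  have h1 := Lagrange.eq_interpolate_of_eval_eq (f := P - Q) (v := fun i => -s i)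
    (s := Finset.univ) (fun j => P.eval (-s j)) hinj (degree_nodal_sub_nodal_lt _ _) fun j _ => by
      have : Q.eval (-s j) = 0 := by
        rw [hQ]; exact Finset.prod_eq_zero (Finset.mem_univ j) (by simp)
      simp [this]
  have h2 := congrArg (Polynomial.eval z) h1
  rw [Lagrange.eval_interpolate_not_at_node _ fun i _ h => hz i (by rw [h]; simp),
    Polynomial.eval_sub, sub_eq_iff_eq_add, hP] at h2
  have hQ0 : Q.eval z ≠ 0 := by
    rw [hQ]; exact Finset.prod_ne_zero_iff.2 fun i _ => hz i
  rw [Finset.prod_div_distrib, h2, ← hQ z]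
  change (Polynomial.eval z Q * _ + Polynomial.eval z Q) / _ = _
  rw [add_div, mul_div_cancel_left₀ _ hQ0, div_self hQ0, add_comm]
  congr 1
  refine Finset.sum_congr rfl fun j _ => ?_
  rw [interlacingResidue, Lagrange.nodalWeight, hP]
  simp only [sub_neg_eq_add, neg_add_eq_sub]
  rw [div_eq_mul_inv]
  ring

end PartialFractions

namespace Interlaces

variable {ι : Type*} {α s : ι → ℝ} [Fintype ι] [DecidableEq ι]

/-- Pairing each `α k - s j` with `s k - s j` leaves positive factors for `k ≠ j`; only `α j - s j`
is negative. -/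
lemma residue_neg (h : Interlaces α s) (j : ι) : interlacingResidue α s j < 0 := by
  have e : interlacingResidue α s j =
      (α j - s j) * ∏ k ∈ Finset.univ.erase j, ((α k - s j) * (s k - s j)⁻¹) := by
    rw [interlacingResidue, Finset.prod_mul_distrib,
      ← Finset.mul_prod_erase Finset.univ _ (Finset.mem_univ j), mul_assoc]
  rw [e]
  refine mul_neg_of_neg_of_pos (sub_neg.2 (h.lt j)) (Finset.prod_pos fun k hk => ?_)
  have hne := Finset.ne_of_mem_erase hk
  rw [← div_eq_mul_inv]
  rcases pos_and_pos_or_neg_and_neg_of_mul_pos (h.mul_pos k j hne) with ⟨h1, h2⟩ | ⟨h1, h2⟩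
  · exact div_pos h1 h2
  · exact div_pos_of_neg_of_neg h1 h2

/-- Partial fractions of a rational function with interlacing zeros and poles. -/
lemma prod_div_eq (h : Interlaces α s) {z : ℂ} (hz : ∀ i, z + s i ≠ 0) :
    ∏ i, (z + α i) / (z + s i) = ((∏ i, α i / s i : ℝ) : ℂ) +
      ∑ j, ((-interlacingResidue α s j / s j : ℝ) : ℂ) * (z / (z + s j)) := by
  have hinj : Function.Injective fun i => (s i : ℂ) :=
    Complex.ofReal_injective.comp h.injective_right
  -- The value at `0` fixes the constant, since `r / (z + s) = r / s - (r / s) · z / (z + s)`.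
  have h0 := prod_div_eq_one_add_sum α s h.injective_right (z := 0)
    fun i => by simpa using (h.pos_right i).ne'
  simp only [zero_add] at h0
  have hr : ∀ j, interlacingResidue (fun i => (α i : ℂ)) (fun i => (s i : ℂ)) j =
      ((interlacingResidue α s j : ℝ) : ℂ) := fun j => by
    simp [interlacingResidue]
  rw [prod_div_eq_one_add_sum _ _ hinj hz, h0]
  push_cast
  simp_rw [hr]
  rw [add_assoc, ← Finset.sum_add_distrib]
  congr 1
  refine Finset.sum_congr rfl fun j _ => ?_
  have h1 := hz j
  have h2 : (s j : ℂ) ≠ 0 := Complex.ofReal_ne_zero.2 (h.pos_right j).ne'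
  field_simp
  ring

end Interlaces

section Zeros

variable {ι : Type*} [Fintype ι] [DecidableEq ι]

/-- The numerator of `c + ∑ aᵢ x / (x + sᵢ)` over the common denominator `∏ (x + sᵢ)`. -/
def kernelNumerator (c : ℝ) (a s : ι → ℝ) (x : ℝ) : ℝ :=
  c * ∏ k, (x + s k) + ∑ i, a i * (x * ∏ k ∈ Finset.univ.erase i, (x + s k))

lemma kernelNumerator_neg (c : ℝ) (a s : ι → ℝ) (j : ι) :
    kernelNumerator c a s (-s j) =
      -(a j * s j) * ∏ k ∈ Finset.univ.erase j, (s k - s j) := by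
  rw [kernelNumerator, Finset.prod_eq_zero (Finset.mem_univ j) (by simp), mul_zero, zero_add,
    Finset.sum_eq_single j]
  · simp only [neg_add_eq_sub]; ring
  · intro i _ hi
    rw [Finset.prod_eq_zero (Finset.mem_erase.2 ⟨hi.symm, Finset.mem_univ j⟩) (by simp)]
    simp
  · simp

lemma continuous_kernelNumerator (c : ℝ) (a s : ι → ℝ) : Continuous (kernelNumerator c a s) := by
  unfold kernelNumerator
  fun_prop

/-- Take for `q` the largest `s p` below `s i`, or `0` if there is none. No other `s k` separates `s
p` from `s i`, so only the factors pairing `i` with `p` have opposite signs; at `0` the numerator is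
`c ∏ s k > 0`. -/
lemma exists_sign_change {c : ℝ} {a s : ι → ℝ} (hc : 0 < c) (ha : ∀ i, 0 < a i)
    (hs : ∀ i, 0 < s i) (hinj : Function.Injective s) (i : ι) :
    ∃ q, 0 ≤ q ∧ q < s i ∧ (∀ j, s j < s i → s j ≤ q) ∧
      kernelNumerator c a s (-s i) * kernelNumerator c a s (-q) < 0 := by
  by_cases hS : (Finset.univ.filter fun j => s j < s i).Nonempty
  · obtain ⟨p, hp, hmax⟩ := Finset.exists_max_image _ s hS
    have hpi : s p < s i := (Finset.mem_filter.1 hp).2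
    have hne : p ≠ i := fun h => by rw [h] at hpi; exact hpi.false
    refine ⟨s p, (hs p).le, hpi, fun j hj => hmax j (by simp [hj]), ?_⟩
    rw [kernelNumerator_neg, kernelNumerator_neg,
      ← Finset.mul_prod_erase (Finset.univ.erase i) _ (Finset.mem_erase.2 ⟨hne, Finset.mem_univ p⟩),
      ← Finset.mul_prod_erase (Finset.univ.erase p) _
        (Finset.mem_erase.2 ⟨hne.symm, Finset.mem_univ i⟩), Finset.erase_right_comm (a := p)]
    have hprod : 0 < ∏ k ∈ (Finset.univ.erase i).erase p, ((s k - s i) * (s k - s p)) := by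
      refine Finset.prod_pos fun k hk => ?_
      rw [Finset.mem_erase, Finset.mem_erase] at hk
      rcases lt_or_gt_of_ne (hinj.ne hk.2.1) with h | h
      · have h1 : s k < s p := lt_of_le_of_ne (hmax k (by simp [h])) (hinj.ne hk.1)
        exact mul_pos_of_neg_of_neg (by linarith) (by linarith)
      · exact mul_pos (by linarith) (by linarith)
    rw [Finset.prod_mul_distrib] at hprod
    have h1 := mul_pos (mul_pos (ha i) (hs i)) (mul_pos (ha p) (hs p))
    have h2 := mul_pos h1 (mul_pos (mul_pos (sub_pos.2 hpi) (sub_pos.2 hpi)) hprod)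
    linarith
  · have hall : ∀ k, k ≠ i → s i < s k := fun k hk => by
      by_contra h
      exact hS ⟨k, by simpa using lt_of_le_of_ne (not_lt.1 h) (hinj.ne hk)⟩
    refine ⟨0, le_rfl, hs i, fun j hj => ?_, ?_⟩
    · by_cases hji : j = i
      · rw [hji] at hj; exact (hj.false).elim
      · exact ((hall j hji).trans hj).false.elim
    · rw [kernelNumerator_neg]
      have h0 : kernelNumerator c a s (-0) = c * ∏ k, s k := by simp [kernelNumerator]
      rw [h0]
      have h1 : 0 < ∏ k ∈ Finset.univ.erase i, (s k - s i) :=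
        Finset.prod_pos fun k hk => sub_pos.2 (hall k (Finset.ne_of_mem_erase hk))
      have h2 : 0 < ∏ k, s k := Finset.prod_pos fun k _ => hs k
      have := mul_pos (mul_pos (mul_pos (ha i) (hs i)) h1) (mul_pos hc h2)
      linarith

lemma exists_interlacing_zeros {c : ℝ} {a s : ι → ℝ} (hc : 0 < c) (ha : ∀ i, 0 < a i)
    (hs : ∀ i, 0 < s i) (hinj : Function.Injective s) :
    ∃ α : ι → ℝ, Interlaces α s ∧ ∀ i, kernelNumerator c a s (-α i) = 0 := by
  have : ∀ i, ∃ α, 0 < α ∧ α < s i ∧ (∀ j, s j < s i → s j < α) ∧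
      kernelNumerator c a s (-α) = 0 := fun i => by
    obtain ⟨q, hq0, hqi, hqs, hneg⟩ := exists_sign_change hc ha hs hinj i
    have hcont := (continuous_kernelNumerator c a s).continuousOn (s := Icc (-s i) (-q))
    have hle : -s i ≤ -q := by linarith
    have : (0 : ℝ) ∈ kernelNumerator c a s '' Ioo (-s i) (-q) := by
      rcases mul_neg_iff.1 hneg with ⟨h1, h2⟩ | ⟨h1, h2⟩
      · exact intermediate_value_Ioo' hle hcont ⟨h2, h1⟩
      · exact intermediate_value_Ioo hle hcont ⟨h1, h2⟩
    obtain ⟨x, ⟨hx1, hx2⟩, hx⟩ := this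
    exact ⟨-x, by linarith, by linarith, fun j hj => by have := hqs j hj; linarith,
      by rwa [neg_neg]⟩
  choose α h0 h1 h2 h3 using this
  refine ⟨α, ⟨h0, h1, fun i j hij => ?_⟩, h3⟩
  rcases lt_or_gt_of_ne (hinj.ne hij) with h | h
  · have := h1 i
    exact mul_pos_of_neg_of_neg (by linarith) (by linarith)
  · have := h2 i j h
    exact mul_pos (by linarith) (by linarith)

open Polynomial in
/-- A positive combination of the functions `z / (z + sᵢ)` has interlacing zeros and poles. -/
lemma exists_interlaces_prod {c : ℝ} {a s : ι → ℝ} (hc : 0 < c) (ha : ∀ i, 0 < a i)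
    (hs : ∀ i, 0 < s i) (hinj : Function.Injective s) :
    ∃ α : ι → ℝ, Interlaces α s ∧ ∀ z : ℂ, (∀ i, z + s i ≠ 0) →
      (c : ℂ) + ∑ i, (a i : ℂ) * (z / (z + s i)) =
        ((c + ∑ i, a i : ℝ) : ℂ) * ∏ i, (z + α i) / (z + s i) := by
  obtain ⟨α, hα, hzero⟩ := exists_interlacing_zeros hc ha hs hinj
  refine ⟨α, hα, fun z hz => ?_⟩
  set P := Lagrange.nodal Finset.univ fun i => -α i
  set Q := Lagrange.nodal Finset.univ fun i => -s i
  let R : ι → ℝ[X] := fun i => X * Lagrange.nodal (Finset.univ.erase i) fun i => -s i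
  -- `R i` is again monic of full degree: the node `-s i` is replaced by `0`.
  have hR : ∀ i, R i = Lagrange.nodal Finset.univ (Function.update (fun i => -s i) i 0) := by
    intro i
    rw [Lagrange.nodal, ← Finset.mul_prod_erase Finset.univ _ (Finset.mem_univ i)]
    simp only [R, Function.update_self, C_0, sub_zero]
    congr 1
    refine Finset.prod_congr rfl fun k hk => ?_
    rw [Function.update_of_ne (Finset.ne_of_mem_erase hk)]
  -- The numerator minus `(c + ∑ aᵢ) P`, grouped into differences of monic polynomials: the degree
  -- drops below the number of zeros `-α i`, which forces it to vanish.
  have hmem : C c * (Q - P) + ∑ i, C (a i) * (R i - P) ∈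
      degreeLT ℝ (Finset.univ : Finset ι).card := by
    refine Submodule.add_mem _ ?_ (Submodule.sum_mem _ fun i _ => ?_)
    · rw [← smul_eq_C_mul]
      exact Submodule.smul_mem _ _ (mem_degreeLT.2 (degree_nodal_sub_nodal_lt _ _))
    · rw [← smul_eq_C_mul, hR]
      exact Submodule.smul_mem _ _ (mem_degreeLT.2 (degree_nodal_sub_nodal_lt _ _))
  have hzero' : C c * (Q - P) + ∑ i, C (a i) * (R i - P) = 0 := by
    refine eq_zero_of_degree_lt_of_eval_index_eq_zero (v := fun i => -α i) (s := Finset.univ)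
      (neg_injective.comp hα.injective_left).injOn (mem_degreeLT.1 hmem) fun j _ => ?_
    have hPj : P.eval (-α j) = 0 := by
      simp only [P, Lagrange.eval_nodal]
      exact Finset.prod_eq_zero (Finset.mem_univ j) (by simp)
    have := hzero j
    simp only [eval_add, eval_mul, eval_C, eval_sub, hPj, sub_zero, eval_finsetSum]
    simpa [Q, R, Lagrange.eval_nodal, kernelNumerator] using this
  have h1 := congrArg (Polynomial.aeval z) hzero'
  have hPz : Polynomial.aeval z P = ∏ i, (z + α i) := by
    simp [P, Lagrange.nodal]
  have hQz : Polynomial.aeval z Q = ∏ i, (z + s i) := by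
    simp [Q, Lagrange.nodal]
  have hRz : ∀ i, Polynomial.aeval z (R i) = z * ∏ k ∈ Finset.univ.erase i, (z + s k) := by
    simp [R, Lagrange.nodal]
  have hQ0 : ∏ i, (z + (s i : ℂ)) ≠ 0 := Finset.prod_ne_zero_iff.2 fun i _ => hz i
  simp only [map_add, map_mul, map_sub, map_sum, map_zero, aeval_C, Complex.coe_algebraMap, hPz,
    hQz, hRz, mul_sub, Finset.sum_sub_distrib, ← Finset.sum_mul] at h1
  rw [Finset.prod_div_distrib, mul_div_assoc', eq_div_iff hQ0, add_mul, Finset.sum_mul]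
  have h2 : ∀ i, (a i : ℂ) * (z / (z + s i)) * ∏ k, (z + (s k : ℂ)) =
      a i * (z * ∏ k ∈ Finset.univ.erase i, (z + (s k : ℂ))) := fun i => by
    rw [← Finset.mul_prod_erase Finset.univ _ (Finset.mem_univ i)]
    have := hz i
    field_simp
  simp_rw [h2]
  push_cast
  linear_combination h1

end Zeros

/-! ### The transform `ψ ↦ ψ†` of rational functions -/

lemma integral_Ioi_div_sq_add_sq {ξ t : ℝ} (hξ : 0 < ξ) (ht : 0 < t) :
    IntegrableOn (fun ζ : ℝ => ξ ^ 2 / (ξ ^ 2 * ζ ^ 2 + t ^ 2)) (Ioi 0) ∧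
    ∫ ζ in Ioi (0 : ℝ), ξ ^ 2 / (ξ ^ 2 * ζ ^ 2 + t ^ 2) = ξ / t * (Real.pi / 2) := by
  have hb : 0 < ξ / t := div_pos hξ ht
  have e : ∀ ζ : ℝ, ξ ^ 2 / (ξ ^ 2 * ζ ^ 2 + t ^ 2) =
      (ξ / t) ^ 2 * (1 + (ξ / t * ζ) ^ 2)⁻¹ := fun ζ => by
    have : ξ ^ 2 * ζ ^ 2 + t ^ 2 ≠ 0 := by positivity
    have h2 : 1 + (ξ / t * ζ) ^ 2 = (ξ ^ 2 * ζ ^ 2 + t ^ 2) / t ^ 2 := by field_simp; ring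
    rw [h2]
    field_simp
  simp_rw [e]
  constructor
  · exact ((integrable_inv_one_add_sq.comp_mul_left' hb.ne').const_mul _).integrableOn
  · rw [integral_const_mul, integral_comp_mul_left_Ioi (fun x : ℝ => (1 + x ^ 2)⁻¹) 0 hb,
      mul_zero, integral_Ioi_inv_one_add_sq, Real.arctan_zero, sub_zero, smul_eq_mul]
    field_simp

lemma integral_Ioi_two_mul_div {ξ t : ℝ} (hξ : 0 < ξ) (ht : 0 < t) (hne : t ≠ ξ) :
    ∫ ζ in Ioi (0 : ℝ), 2 * t / (ξ ^ 2 * ζ ^ 2 + t ^ 2) * (1 + ζ ^ 2)⁻¹ =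
      Real.pi * (t + ξ)⁻¹ := by
  have h1 : t - ξ ≠ 0 := sub_ne_zero.2 hne
  have h2 : t + ξ ≠ 0 := by positivity
  have hd : t ^ 2 - ξ ^ 2 ≠ 0 := by
    rw [sq_sub_sq]; exact mul_ne_zero h2 h1
  have e : ∀ ζ : ℝ, 2 * t / (ξ ^ 2 * ζ ^ 2 + t ^ 2) * (1 + ζ ^ 2)⁻¹ =
      2 * t / (t ^ 2 - ξ ^ 2) * ((1 + ζ ^ 2)⁻¹ - ξ ^ 2 / (ξ ^ 2 * ζ ^ 2 + t ^ 2)) := fun ζ => by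
    have h3 : ξ ^ 2 * ζ ^ 2 + t ^ 2 ≠ 0 := by positivity
    have h4 : 1 + ζ ^ 2 ≠ 0 := by positivity
    field_simp
    ring
  obtain ⟨i, hi⟩ := integral_Ioi_div_sq_add_sq hξ ht
  simp_rw [e]
  rw [integral_const_mul, integral_sub integrable_inv_one_add_sq.integrableOn i, hi,
    integral_Ioi_inv_one_add_sq, Real.arctan_zero, sub_zero]
  have h5 : t ^ 2 - ξ ^ 2 = (t + ξ) * (t - ξ) := sq_sub_sq t ξ
  rw [h5]
  field_simp

lemma integral_two_mul_div_sq_add {c a b : ℝ} (hc : 0 ≤ c) (ha : 0 < a) (hb : 0 < b) :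
    ∫ t in a..b, 2 * t / (c + t ^ 2) = Real.log (c + b ^ 2) - Real.log (c + a ^ 2) := by
  have hpos : ∀ t ∈ uIcc a b, 0 < t := fun t ht =>
    (lt_min ha hb).trans_le (by rw [uIcc, mem_Icc] at ht; exact ht.1)
  have hne : ∀ t ∈ uIcc a b, c + t ^ 2 ≠ 0 := fun t ht => by
    have := hpos t ht
    positivity
  refine intervalIntegral.integral_eq_sub_of_hasDerivAt
    (f := fun t => Real.log (c + t ^ 2)) (fun t ht => ?_) ?_
  · have h1 : HasDerivAt (fun t : ℝ => c + t ^ 2) (2 * t) t := by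
      simpa using (hasDerivAt_pow 2 t).const_add c
    exact h1.log (hne t ht)
  · exact ContinuousOn.intervalIntegrable (ContinuousOn.div (by fun_prop) (by fun_prop) hne)

/-- Write the difference of logarithms as `∫ 2t / (ξ²ζ² + t²) dt` from `a` to `b` and exchange
integrals. The inner integral is `π / (t + ξ)`, which integrates back to a logarithm. -/
lemma integral_log_sub_log {ξ a b : ℝ} (hξ : 0 < ξ) (ha : 0 < a) (hb : 0 < b) :
    IntegrableOn (fun ζ : ℝ => (Real.log (ξ ^ 2 * ζ ^ 2 + b ^ 2) -
      Real.log (ξ ^ 2 * ζ ^ 2 + a ^ 2)) / (1 + ζ ^ 2)) (Ioi 0) ∧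
    ∫ ζ in Ioi (0 : ℝ), (Real.log (ξ ^ 2 * ζ ^ 2 + b ^ 2) -
      Real.log (ξ ^ 2 * ζ ^ 2 + a ^ 2)) / (1 + ζ ^ 2) =
      Real.pi * (Real.log (ξ + b) - Real.log (ξ + a)) := by
  have hmin : 0 < min a b := lt_min ha hb
  have hprod : Integrable (Function.uncurry fun t ζ : ℝ =>
      2 * t / (ξ ^ 2 * ζ ^ 2 + t ^ 2) * (1 + ζ ^ 2)⁻¹)
      ((volume.restrict (uIoc a b)).prod (volume.restrict (Ioi 0))) := by
    have hdom : Integrable (fun p : ℝ × ℝ => (2 / min a b) * (1 + p.2 ^ 2)⁻¹)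
        ((volume.restrict (uIoc a b)).prod (volume.restrict (Ioi 0))) := by
      have h1 : Integrable (fun _ : ℝ => 2 / min a b) (volume.restrict (uIoc a b)) := by
        have : IntegrableOn (fun _ : ℝ => 2 / min a b) (uIoc a b) := by
          simp [uIoc]
        exact this
      exact h1.mul_prod (integrable_inv_one_add_sq.integrableOn (s := Ioi 0))
    refine hdom.mono' ?_ ?_
    · refine Measurable.aestronglyMeasurable ?_
      simp only [Function.uncurry_def]
      fun_prop
    · rw [Measure.prod_restrict]
      filter_upwards [ae_restrict_mem (measurableSet_uIoc.prod measurableSet_Ioi)] with p hp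
      obtain ⟨⟨hp1, -⟩, -⟩ := hp
      have hp0 : 0 < p.1 := hmin.trans hp1
      simp only [Function.uncurry]
      rw [Real.norm_of_nonneg (by positivity)]
      refine mul_le_mul_of_nonneg_right ?_ (by positivity)
      rw [div_le_div_iff₀ (by positivity) hmin]
      have : p.1 * min a b ≤ p.1 * p.1 := mul_le_mul_of_nonneg_left hp1.le hp0.le
      nlinarith [sq_nonneg (ξ * p.2)]
  have hinner : ∀ ζ : ℝ, ∫ t in a..b, 2 * t / (ξ ^ 2 * ζ ^ 2 + t ^ 2) * (1 + ζ ^ 2)⁻¹ =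
      (Real.log (ξ ^ 2 * ζ ^ 2 + b ^ 2) - Real.log (ξ ^ 2 * ζ ^ 2 + a ^ 2)) / (1 + ζ ^ 2) :=
    fun ζ => by
    rw [intervalIntegral.integral_mul_const, integral_two_mul_div_sq_add (by positivity) ha hb,
      div_eq_mul_inv]
  constructor
  · have h1 := hprod.integral_prod_right
    have h2 : IntegrableOn (fun ζ : ℝ =>
        ∫ t in a..b, 2 * t / (ξ ^ 2 * ζ ^ 2 + t ^ 2) * (1 + ζ ^ 2)⁻¹) (Ioi 0) := by
      simp_rw [intervalIntegral.intervalIntegral_eq_integral_uIoc, smul_eq_mul]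
      exact h1.const_mul _
    simpa only [hinner] using h2
  · have h1 := intervalIntegral_integral_swap hprod
    simp_rw [hinner] at h1
    rw [← h1]
    have hpos : ∀ t ∈ uIoc a b, 0 < t := fun t ht => hmin.trans ht.1
    have h2 : ∫ t in a..b, ∫ ζ in Ioi (0 : ℝ),
        2 * t / (ξ ^ 2 * ζ ^ 2 + t ^ 2) * (1 + ζ ^ 2)⁻¹ =
        ∫ t in a..b, Real.pi * (t + ξ)⁻¹ := by
      refine intervalIntegral.integral_congr_ae ?_
      -- The partial fractions in `ζ²` degenerate at `t = ξ`, a null set.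
      filter_upwards [Measure.ae_ne volume ξ] with t ht hmem
      exact integral_Ioi_two_mul_div hξ (hpos t hmem) ht
    rw [h2, intervalIntegral.integral_const_mul]
    congr 1
    have hpos' : ∀ t ∈ uIcc a b, t + ξ ≠ 0 := fun t ht => by
      rw [uIcc, mem_Icc] at ht
      have := hmin.trans_le ht.1
      positivity
    rw [intervalIntegral.integral_eq_sub_of_hasDerivAt (f := fun t => Real.log (t + ξ))
      (f' := fun t => (t + ξ)⁻¹)
      (fun t ht => ?_) (ContinuousOn.intervalIntegrable
        (ContinuousOn.inv₀ (by fun_prop) hpos')), add_comm b, add_comm a]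
    simpa using ((hasDerivAt_id t).add_const ξ).log (hpos' t ht)

section DaggerProd

variable {ι : Type*} [Fintype ι]

/-- `ψ†` for a rational function `ψ` with negative zeros and poles. -/
lemma dagger_prod {C : ℝ} (hC : 0 < C) {α s : ι → ℝ} (hα : ∀ i, 0 < α i) (hs : ∀ i, 0 < s i)
    {ψ : ℝ → ℝ} (hψ : ∀ x, 0 < x → ψ x = C * ∏ i, (x + α i) / (x + s i)) {ξ : ℝ}
    (hξ : 0 < ξ) :
    dagger ψ ξ = √C * ∏ i, (ξ + √(α i)) / (ξ + √(s i)) := by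
  have hα' : ∀ i, 0 < √(α i) := fun i => Real.sqrt_pos.2 (hα i)
  have hs' : ∀ i, 0 < √(s i) := fun i => Real.sqrt_pos.2 (hs i)
  have e : ∀ ζ ∈ Ioi (0 : ℝ), Real.log (ψ (ξ ^ 2 * ζ ^ 2)) / (1 + ζ ^ 2) =
      Real.log C * (1 + ζ ^ 2)⁻¹ + ∑ i, (Real.log (ξ ^ 2 * ζ ^ 2 + √(α i) ^ 2) -
        Real.log (ξ ^ 2 * ζ ^ 2 + √(s i) ^ 2)) / (1 + ζ ^ 2) := fun ζ hζ => by
    have hζ' : 0 < ζ := hζ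
    have hx : 0 < ξ ^ 2 * ζ ^ 2 := by positivity
    have h1 : ∀ i, 0 < (ξ ^ 2 * ζ ^ 2 + α i) / (ξ ^ 2 * ζ ^ 2 + s i) := fun i =>
      div_pos (add_pos hx (hα i)) (add_pos hx (hs i))
    rw [hψ _ hx, Real.log_mul hC.ne' (Finset.prod_pos fun i _ => h1 i).ne',
      Real.log_prod fun i _ => (h1 i).ne', ← Finset.sum_div, ← div_eq_mul_inv, ← add_div]
    congr 2
    refine Finset.sum_congr rfl fun i _ => ?_
    rw [Real.log_div (add_pos hx (hα i)).ne' (add_pos hx (hs i)).ne', Real.sq_sqrt (hα i).le,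
      Real.sq_sqrt (hs i).le]
  have hint := fun i => integral_log_sub_log hξ (hs' i) (hα' i)
  rw [dagger, setIntegral_congr_fun measurableSet_Ioi e,
    integral_add (integrable_inv_one_add_sq.integrableOn.const_mul _)
      (integrable_finsetSum _ fun i _ => (hint i).1),
    integral_const_mul, integral_Ioi_inv_one_add_sq, integral_finsetSum _ fun i _ => (hint i).1]
  simp_rw [(hint _).2]
  rw [← Finset.mul_sum, Real.arctan_zero, sub_zero]
  have h2 : 1 / Real.pi * (Real.log C * (Real.pi / 2) + Real.pi *
      ∑ i, (Real.log (ξ + √(α i)) - Real.log (ξ + √(s i)))) =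
      Real.log √C + ∑ i, (Real.log (ξ + √(α i)) - Real.log (ξ + √(s i))) := by
    rw [Real.log_sqrt hC.le]
    have := Real.pi_pos
    field_simp
  rw [h2, Real.exp_add, Real.exp_log (Real.sqrt_pos.2 hC), Real.exp_sum]
  congr 1
  refine Finset.prod_congr rfl fun i _ => ?_
  have h3 := hα' i
  have h4 := hs' i
  rw [Real.exp_sub, Real.exp_log (by positivity), Real.exp_log (by positivity)]

end DaggerProd

/-! ### Approximation by rational functions -/

/-- Index of the cell of the uniform partition into `n + 1` cells containing a point. -/
noncomputable def gridIndex (n : ℕ) (u : I) : Fin (n + 1) :=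
  -- The minimum matters only at `u = 1`, which joins the last cell.
  ⟨min ⌊(u : ℝ) * (n + 1)⌋₊ n, Nat.lt_succ_of_le (min_le_right _ _)⟩

/-- Midpoints of the cells of the uniform partition into `n + 1` cells. -/
noncomputable def gridPoint (n : ℕ) (i : Fin (n + 1)) : I :=
  ⟨((i : ℕ) + 1 / 2) / (n + 1), by positivity, by
    rw [div_le_one (by positivity)]
    have : ((i : ℕ) : ℝ) ≤ n := by exact_mod_cast Nat.lt_succ_iff.1 i.2
    linarith⟩

lemma gridPoint_pos (n : ℕ) (i : Fin (n + 1)) : 0 < (gridPoint n i : ℝ) := by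
  simp only [gridPoint]
  positivity

lemma gridPoint_lt_one (n : ℕ) (i : Fin (n + 1)) : (gridPoint n i : ℝ) < 1 := by
  simp only [gridPoint]
  rw [div_lt_one (by positivity)]
  have : ((i : ℕ) : ℝ) ≤ n := by exact_mod_cast Nat.lt_succ_iff.1 i.2
  linarith

lemma gridPoint_injective (n : ℕ) : Function.Injective (gridPoint n) := by
  intro i j h
  have h1 := congrArg Subtype.val h
  simp only [gridPoint] at h1
  have hn : ((n : ℝ) + 1) ≠ 0 := by positivity
  rw [div_left_inj' hn, add_left_inj] at h1
  exact Fin.ext (by exact_mod_cast h1)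

lemma measurable_gridIndex (n : ℕ) : Measurable (gridIndex n) := by
  have h1 : Measurable fun u : I => ⌊(u : ℝ) * (n + 1)⌋₊ :=
    Nat.measurable_floor.comp (by fun_prop)
  exact (measurable_of_countable fun k : ℕ =>
    (⟨min k n, Nat.lt_succ_of_le (min_le_right _ _)⟩ : Fin (n + 1))).comp h1

lemma dist_gridPoint_gridIndex_le (n : ℕ) (u : I) :
    dist (gridPoint n (gridIndex n u)) u ≤ 1 / ((n : ℝ) + 1) := by
  have hn : (0 : ℝ) < n + 1 := by positivity
  have hu0 := u.2.1
  have hu1 := u.2.2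
  have h1 := Nat.floor_le (mul_nonneg hu0 hn.le)
  have h2 := Nat.lt_floor_add_one ((u : ℝ) * (n + 1))
  rw [Subtype.dist_eq, Real.dist_eq]
  simp only [gridPoint, gridIndex]
  have e : ((min ⌊(u : ℝ) * (n + 1)⌋₊ n : ℕ) + 1 / 2 : ℝ) / (n + 1) - u =
      ((min ⌊(u : ℝ) * (n + 1)⌋₊ n : ℕ) + 1 / 2 - u * (n + 1)) / (n + 1) := by
    field_simp
  rw [e, abs_div, abs_of_pos hn, div_le_div_iff_of_pos_right hn, abs_le]
  rcases le_total ⌊(u : ℝ) * (n + 1)⌋₊ n with h | h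
  · rw [min_eq_left h]
    constructor <;> linarith
  · rw [min_eq_right h]
    have h3 : (n : ℝ) ≤ ⌊(u : ℝ) * (n + 1)⌋₊ := by exact_mod_cast h
    have h4 : (u : ℝ) * (n + 1) ≤ n + 1 := by nlinarith
    constructor <;> linarith

lemma tendsto_gridPoint_gridIndex (u : I) :
    Tendsto (fun n => gridPoint n (gridIndex n u)) atTop (𝓝 u) :=
  tendsto_iff_dist_tendsto_zero.2 (squeeze_zero (fun _ => dist_nonneg)
    (fun n => dist_gridPoint_gridIndex_le n u) tendsto_one_div_add_atTop_nhds_zero_nat)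

lemma exists_norm_pickKernel_le {z : ℂ} (hz : z ∈ Complex.slitPlane) :
    ∃ B, ∀ u, ‖pickKernel z u‖ ≤ B := by
  obtain ⟨B, hB⟩ := isCompact_univ.exists_bound_of_continuousOn
    (continuous_pickKernel hz).continuousOn
  exact ⟨B, fun u => hB u (mem_univ u)⟩

lemma tendsto_sum_gridPoint (ρ : Measure I) [IsFiniteMeasure ρ] {z : ℂ}
    (hz : z ∈ Complex.slitPlane) :
    Tendsto (fun n : ℕ => ∑ i, (((ρ.map (gridIndex n)).real {i} : ℝ) : ℂ) *
      pickKernel z (gridPoint n i)) atTop (𝓝 (pickTransform ρ z)) := by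
  obtain ⟨B, hB⟩ := exists_norm_pickKernel_le hz
  have e : ∀ n : ℕ, ∑ i, (((ρ.map (gridIndex n)).real {i} : ℝ) : ℂ) *
      pickKernel z (gridPoint n i) = ∫ u, pickKernel z (gridPoint n (gridIndex n u)) ∂ρ := by
    intro n
    have hm := measurable_gridIndex n
    rw [← integral_map (f := fun i => pickKernel z (gridPoint n i)) hm.aemeasurable
      (measurable_of_countable _).aestronglyMeasurable, integral_fintype Integrable.of_finite]
    simp [Complex.real_smul]
  simp_rw [e]
  refine tendsto_integral_of_dominated_convergence (fun _ => B) (fun n => ?_)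
    (integrable_const _) (fun n => Eventually.of_forall fun u => hB _)
    (Eventually.of_forall fun u =>
      ((continuous_pickKernel hz).tendsto u).comp (tendsto_gridPoint_gridIndex u))
  exact ((measurable_of_countable fun i => pickKernel z (gridPoint n i)).comp
    (measurable_gridIndex n)).aestronglyMeasurable

lemma pickKernel_eq_mul_div {u : I} (hu : (u : ℝ) < 1) {z : ℂ} :
    pickKernel z u = (((1 - u : ℝ)⁻¹ : ℝ) : ℂ) * (z / (z + pickRate u)) := by
  have h : (1 : ℂ) - ((u : ℝ) : ℂ) ≠ 0 := by
    rw [← Complex.ofReal_one, ← Complex.ofReal_sub]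
    exact Complex.ofReal_ne_zero.2 (by linarith)
  have e : (1 - ((u : ℝ) : ℂ)) * z + ((u : ℝ) : ℂ) =
      (1 - ((u : ℝ) : ℂ)) * (z + ((u : ℝ) : ℂ) / (1 - ((u : ℝ) : ℂ))) := by
    field_simp
  rw [pickKernel, pickRate, e]
  push_cast
  rw [← div_div, div_eq_mul_inv z, mul_comm z, mul_div_assoc]

lemma add_ofReal_ne_zero {z : ℂ} (hz : z ∈ Complex.slitPlane) {s : ℝ} (hs : 0 < s) :
    z + s ≠ 0 := by
  intro h
  rw [eq_neg_of_add_eq_zero_left h, Complex.mem_slitPlane_iff] at hz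
  simp at hz
  linarith

/-- Every superposition of the kernels is a limit of rational functions with interlacing zeros and
poles. -/
lemma exists_tendsto_prod (ρ : Measure I) [IsFiniteMeasure ρ] :
    ∃ (C : ℕ → ℝ) (α s : ∀ n : ℕ, Fin (n + 1) → ℝ), (∀ n, 0 < C n) ∧
      (∀ n, Interlaces (α n) (s n)) ∧ ∀ z ∈ Complex.slitPlane,
        Tendsto (fun n => (C n : ℂ) * ∏ i, (z + α n i) / (z + s n i)) atTop
          (𝓝 (pickTransform ρ z)) := by
  -- Cells may have measure zero, while the zero-finding step needs strictly positive weights. The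
  -- extra `1 / (n + 1) ^ 2` on `n + 1` cells contributes `O(1 / (n + 1))`; the additive constant `1
  -- / (n + 1)` likewise disappears in the limit.
  let w : ∀ n : ℕ, Fin (n + 1) → ℝ := fun n i =>
    (ρ.map (gridIndex n)).real {i} + (1 / ((n : ℝ) + 1)) ^ 2
  let a : ∀ n : ℕ, Fin (n + 1) → ℝ := fun n i => w n i * (1 - gridPoint n i : ℝ)⁻¹
  let s : ∀ n : ℕ, Fin (n + 1) → ℝ := fun n i => pickRate (gridPoint n i)
  have hc : ∀ n : ℕ, 0 < 1 / ((n : ℝ) + 1) := fun n => by positivity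
  have hg : ∀ n i, 0 < (1 : ℝ) - gridPoint n i := fun n i => sub_pos.2 (gridPoint_lt_one n i)
  have ha : ∀ n i, 0 < a n i := fun n i =>
    mul_pos (add_pos_of_nonneg_of_pos measureReal_nonneg (pow_pos (hc n) 2)) (inv_pos.2 (hg n i))
  have hs : ∀ n i, 0 < s n i := fun n i => div_pos (gridPoint_pos n i) (hg n i)
  have hinj : ∀ n, Function.Injective (s n) := fun n i j h => by
    refine gridPoint_injective n (Subtype.ext ?_)
    have h1 := hg n i
    have h2 := hg n j
    simp only [s, pickRate] at h
    rw [div_eq_div_iff h1.ne' h2.ne'] at h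
    linarith
  choose α hα hprod using fun n => exists_interlaces_prod (hc n) (ha n) (hs n) (hinj n)
  refine ⟨fun n => 1 / ((n : ℝ) + 1) + ∑ i, a n i, α, s, fun n => ?_, hα, fun z hz => ?_⟩
  · exact add_pos_of_pos_of_nonneg (hc n) (Finset.sum_nonneg fun i _ => (ha n i).le)
  have e : ∀ n : ℕ, ((1 / ((n : ℝ) + 1) + ∑ i, a n i : ℝ) : ℂ) * ∏ i, (z + α n i) / (z + s n i) =
      ((1 / ((n : ℝ) + 1) : ℝ) : ℂ) + (∑ i, (((ρ.map (gridIndex n)).real {i} : ℝ) : ℂ) *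
      pickKernel z (gridPoint n i) +
      ∑ i, ((((1 / ((n : ℝ) + 1)) ^ 2 : ℝ)) : ℂ) * pickKernel z (gridPoint n i)) := by
    intro n
    rw [← hprod n z fun i => add_ofReal_ne_zero hz (hs n i), ← Finset.sum_add_distrib]
    congr 1
    refine Finset.sum_congr rfl fun i _ => ?_
    rw [pickKernel_eq_mul_div (gridPoint_lt_one n i)]
    simp only [a, w, s]
    push_cast
    ring
  simp_rw [e]
  have h1 : Tendsto (fun n : ℕ => ((1 / ((n : ℝ) + 1) : ℝ) : ℂ)) atTop (𝓝 0) := by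
    have := (Complex.continuous_ofReal.tendsto 0).comp
      (tendsto_one_div_add_atTop_nhds_zero_nat (𝕜 := ℝ))
    simpa [Function.comp_def] using this
  have h2 : Tendsto (fun n : ℕ => ∑ i : Fin (n + 1), ((((1 / ((n : ℝ) + 1)) ^ 2 : ℝ)) : ℂ) *
      pickKernel z (gridPoint n i)) atTop (𝓝 0) := by
    obtain ⟨B, hB⟩ := exists_norm_pickKernel_le hz
    have h3 : Tendsto (fun n : ℕ => 1 / ((n : ℝ) + 1) * B) atTop (𝓝 0) := by
      simpa using (tendsto_one_div_add_atTop_nhds_zero_nat (𝕜 := ℝ)).mul_const B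
    refine squeeze_zero_norm (fun n => ?_) h3
    have hn : (0 : ℝ) < n + 1 := by positivity
    calc ‖∑ i : Fin (n + 1), ((((1 / ((n : ℝ) + 1)) ^ 2 : ℝ)) : ℂ) * pickKernel z (gridPoint n i)‖
        ≤ ∑ _i : Fin (n + 1), (1 / ((n : ℝ) + 1)) ^ 2 * B := by
          refine norm_sum_le_of_le _ fun i _ => ?_
          rw [norm_mul, Complex.norm_real, Real.norm_of_nonneg (by positivity)]
          exact mul_le_mul_of_nonneg_left (hB _) (by positivity)
      _ = 1 / ((n : ℝ) + 1) * B := by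
          rw [Finset.sum_const, Finset.card_univ, Fintype.card_fin, nsmul_eq_mul]
          push_cast
          field_simp
  simpa using h1.add ((tendsto_sum_gridPoint ρ hz).add h2)

/-- The identity theorem on the slit plane, for functions which agree on the positive half-line. -/
lemma eqOn_slitPlane_of_eq_ofReal {F G : ℂ → ℂ} (hF : DifferentiableOn ℂ F Complex.slitPlane)
    (hG : DifferentiableOn ℂ G Complex.slitPlane) (h : ∀ x : ℝ, 0 < x → F x = G x) :
    EqOn F G Complex.slitPlane := by
  have hpre : IsPreconnected Complex.slitPlane :=
    (Complex.starConvex_one_slitPlane.isPathConnected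
      Complex.one_mem_slitPlane).isConnected.isPreconnected
  refine (hF.analyticOnNhd Complex.isOpen_slitPlane).eqOn_of_preconnected_of_frequently_eq
    (hG.analyticOnNhd Complex.isOpen_slitPlane) hpre (z₀ := 1) (by simp) ?_
  have hseq : Tendsto (fun n : ℕ => ((1 + 1 / ((n : ℝ) + 1) : ℝ) : ℂ)) atTop (𝓝[≠] 1) := by
    refine tendsto_nhdsWithin_iff.2 ⟨?_, Eventually.of_forall fun n => ?_⟩
    · have h1 := (tendsto_one_div_add_atTop_nhds_zero_nat (𝕜 := ℝ)).const_add 1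
      have h2 := (Complex.continuous_ofReal.tendsto (1 + 0)).comp h1
      simpa [Function.comp_def] using h2
    · rw [mem_compl_singleton_iff, ← Complex.ofReal_one]
      refine fun h => ?_
      have h1 := Complex.ofReal_injective h
      have h2 : 0 < 1 / ((n : ℝ) + 1) := by positivity
      linarith
  exact hseq.frequently (Frequently.of_forall fun n => h _ (by positivity))

/-- Partial fractions give nonnegative coefficients on the half-line; the identity theorem extends
the equality to the slit plane. -/
lemma Interlaces.exists_pickTransform_eq {ι : Type*} [Fintype ι] {α s : ι → ℝ}
    (h : Interlaces α s) {C : ℝ} (hC : 0 ≤ C) :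
    ∃ ρ : FiniteMeasure I, ∀ z ∈ Complex.slitPlane,
      (C : ℂ) * ∏ i, (z + α i) / (z + s i) = pickTransform ρ z := by
  classical
  have hpick : IsPick fun x => C * ∏ i, (x + α i) / (x + s i) := by
    obtain ⟨ρ, hρ⟩ := (IsPick.const (c := C * ∏ i, α i / s i) (mul_nonneg hC
      (Finset.prod_nonneg fun i _ => (div_pos (h.pos i) (h.pos_right i)).le))).add
      (IsPick.sum Finset.univ fun j _ => IsPick.div_add
        (a := C * (-interlacingResidue α s j / s j)) (s := s j)
        (mul_nonneg hC (div_nonneg (neg_nonneg.2 (h.residue_neg j).le) (h.pos_right j).le))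
        (h.pos_right j).le)
    refine ⟨ρ, fun x hx => ?_⟩
    rw [← hρ x hx]
    have := h.prod_div_eq fun i => add_ofReal_ne_zero (ofReal_mem_slitPlane hx) (h.pos_right i)
    push_cast at this ⊢
    rw [this, mul_add, Finset.mul_sum]
    simp only [mul_assoc]
  obtain ⟨ρ, hρ⟩ := hpick
  refine ⟨ρ, eqOn_slitPlane_of_eq_ofReal ?_ (differentiableOn_pickTransform _) fun x hx => ?_⟩
  · refine (differentiableOn_const _).mul (DifferentiableOn.fun_finsetProd fun i _ => ?_)
    exact (by fun_prop : DifferentiableOn ℂ (fun z : ℂ => z + α i) _).div (by fun_prop)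
      fun z hz => add_ofReal_ne_zero hz (h.pos_right i)
  · rw [← hρ x hx]
    push_cast
    rfl

/-! ### Continuity of `ψ ↦ ψ†` and the main theorem -/

lemma integrableOn_abs_log_div : IntegrableOn (fun ζ : ℝ => |Real.log ζ| / (1 + ζ ^ 2)) (Ioi 0) := by
  have hmeas : Measurable fun ζ : ℝ => |Real.log ζ| / (1 + ζ ^ 2) := by fun_prop
  rw [← Ioc_union_Ioi_eq_Ioi zero_le_one]
  refine IntegrableOn.union ?_ ?_
  · have h1 : IntegrableOn Real.log (Ioc 0 1) := by
      have := intervalIntegral.intervalIntegrable_log' (a := 0) (b := 1)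
      rwa [intervalIntegrable_iff_integrableOn_Ioc_of_le zero_le_one] at this
    refine Integrable.mono' h1.norm hmeas.aestronglyMeasurable (Eventually.of_forall fun ζ => ?_)
    rw [Real.norm_of_nonneg (by positivity), Real.norm_eq_abs]
    exact div_le_self (abs_nonneg _) (by nlinarith [sq_nonneg ζ])
  · have h1 := (integrableOn_Ioi_rpow_of_lt (a := -3 / 2) (by norm_num) one_pos).const_mul 2
    refine Integrable.mono' h1 hmeas.aestronglyMeasurable ?_
    filter_upwards [ae_restrict_mem measurableSet_Ioi] with ζ hζ
    have hζ1 : 1 < ζ := hζ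
    have hζ0 : 0 < ζ := one_pos.trans hζ1
    -- At infinity `log ζ ≤ 2 ζ ^ (1 / 2)`, which leaves the integrable tail `2 ζ ^ (-3 / 2)`.
    have h2 := Real.log_le_rpow_div hζ0.le (ε := 1 / 2) (by norm_num)
    have h3 : ζ ^ (1 / 2 : ℝ) = ζ ^ (-3 / 2 : ℝ) * ζ ^ 2 := by
      rw [← Real.rpow_natCast, ← Real.rpow_add hζ0]; norm_num
    have h4 : 0 < ζ ^ (-3 / 2 : ℝ) := Real.rpow_pos_of_pos hζ0 _
    rw [Real.norm_of_nonneg (by positivity), abs_of_nonneg (Real.log_nonneg hζ1.le),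
      div_le_iff₀ (by positivity)]
    rw [h3] at h2
    linarith

lemma neg_sq_mem_slitPlane {ξ : ℂ} (hξ : ξ.im ≠ 0) : -ξ ^ 2 ∈ Complex.slitPlane := by
  rw [Complex.mem_slitPlane_iff]
  by_cases hre : ξ.re = 0
  · left
    simp only [sq, Complex.neg_re, Complex.mul_re, hre]
    have := mul_self_pos.2 hξ
    linarith
  · right
    simp only [sq, Complex.neg_im, Complex.mul_im]
    intro h
    have : ξ.re * ξ.im = 0 := by linarith
    rcases mul_eq_zero.1 this with h | h
    · exact hre h
    · exact hξ h

namespace IsPick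

variable {f : ℝ → ℝ}

lemma pos_of_one_pos (hf : IsPick f) (h1 : 0 < f 1) {x : ℝ} (hx : 0 < x) : 0 < f x :=
  (mul_pos h1 (lt_min one_pos hx)).trans_le (hf.bounds hx).1

lemma one_pos_of_ne_zero (hf : IsPick f) {x : ℝ} (hx : 0 < x) (hne : f x ≠ 0) : 0 < f 1 := by
  refine lt_of_le_of_ne (hf.nonneg one_pos) fun h => hne ?_
  have := hf.bounds hx
  rw [← h, zero_mul, zero_mul] at this
  exact le_antisymm this.2 this.1

lemma abs_log_le (hf : IsPick f) (h1 : 0 < f 1) {x : ℝ} (hx : 0 < x) :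
    |Real.log (f x)| ≤ |Real.log (f 1)| + |Real.log x| := by
  obtain ⟨hl, hu⟩ := hf.bounds hx
  have hfx := hf.pos_of_one_pos h1 hx
  have hmin : 0 < min 1 x := lt_min one_pos hx
  have hmax : 0 < max 1 x := one_pos.trans_le (le_max_left _ _)
  have h2 := Real.log_le_log (mul_pos h1 hmin) hl
  have h3 := Real.log_le_log hfx hu
  rw [Real.log_mul h1.ne' hmin.ne'] at h2
  rw [Real.log_mul h1.ne' hmax.ne'] at h3
  have h4 := neg_abs_le (Real.log (f 1))
  have h5 := le_abs_self (Real.log (f 1))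
  have h6 : -|Real.log x| ≤ Real.log (min 1 x) := by
    rcases min_choice 1 x with h | h <;> rw [h]
    · simp
    · exact neg_abs_le _
  have h7 : Real.log (max 1 x) ≤ |Real.log x| := by
    rcases max_choice 1 x with h | h <;> rw [h]
    · simp
    · exact le_abs_self _
  rw [abs_le]
  constructor <;> linarith

lemma continuousOn (hf : IsPick f) : ContinuousOn f (Ioi 0) := by
  obtain ⟨ρ, hρ⟩ := hf
  have h1 : ContinuousOn (fun x : ℝ => (pickTransform ρ x).re) (Ioi 0) :=
    Complex.continuous_re.comp_continuousOn
      ((differentiableOn_pickTransform (ρ : Measure I)).continuousOn.comp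
        Complex.continuous_ofReal.continuousOn fun x hx => ofReal_mem_slitPlane hx)
  exact h1.congr fun x hx => by simpa using congrArg Complex.re (hρ x hx)

lemma aestronglyMeasurable_dagger (hf : IsPick f) (h1 : 0 < f 1) {ξ : ℝ} (hξ : 0 < ξ) :
    AEStronglyMeasurable (fun ζ : ℝ => Real.log (f (ξ ^ 2 * ζ ^ 2)) / (1 + ζ ^ 2))
      (volume.restrict (Ioi 0)) := by
  have hx : ∀ ζ ∈ Ioi (0 : ℝ), ξ ^ 2 * ζ ^ 2 ∈ Ioi (0 : ℝ) := fun ζ hζ => by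
    have hζ' : 0 < ζ := hζ
    exact mem_Ioi.2 (by positivity)
  refine ContinuousOn.aestronglyMeasurable (ContinuousOn.div (ContinuousOn.log ?_ fun ζ hζ =>
    (hf.pos_of_one_pos h1 (hx ζ hζ)).ne') (by fun_prop) fun ζ _ => by positivity) measurableSet_Ioi
  exact hf.continuousOn.comp (by fun_prop) hx

lemma norm_dagger_integrand_le (hf : IsPick f) (h1 : 0 < f 1) {ξ ζ M : ℝ} (hξ : 0 < ξ)
    (hζ : 0 < ζ) (hM : |Real.log (f 1)| ≤ M) :
    ‖Real.log (f (ξ ^ 2 * ζ ^ 2)) / (1 + ζ ^ 2)‖ ≤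
      (M + 2 * |Real.log ξ|) * (1 + ζ ^ 2)⁻¹ + 2 * (|Real.log ζ| / (1 + ζ ^ 2)) := by
  have hx : 0 < ξ ^ 2 * ζ ^ 2 := by positivity
  have h2 := hf.abs_log_le h1 hx
  have h3 : |Real.log (ξ ^ 2 * ζ ^ 2)| ≤ 2 * |Real.log ξ| + 2 * |Real.log ζ| := by
    rw [Real.log_mul (by positivity) (by positivity), Real.log_pow, Real.log_pow]
    refine (abs_add_le _ _).trans ?_
    rw [abs_mul, abs_mul]
    norm_num
  have hp : (0 : ℝ) < 1 + ζ ^ 2 := by positivity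
  have h4 : (M + 2 * |Real.log ξ|) * (1 + ζ ^ 2)⁻¹ + 2 * (|Real.log ζ| / (1 + ζ ^ 2)) =
      (M + 2 * |Real.log ξ| + 2 * |Real.log ζ|) / (1 + ζ ^ 2) := by
    field_simp
  rw [h4, Real.norm_eq_abs, abs_div, abs_of_pos hp]
  exact div_le_div_of_nonneg_right (by linarith) hp.le

lemma integrableOn_dagger_bound (M ξ : ℝ) :
    IntegrableOn (fun ζ : ℝ => (M + 2 * |Real.log ξ|) * (1 + ζ ^ 2)⁻¹ +
      2 * (|Real.log ζ| / (1 + ζ ^ 2))) (Ioi 0) :=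
  (integrable_inv_one_add_sq.integrableOn.const_mul _).add (integrableOn_abs_log_div.const_mul 2)

lemma integrableOn_dagger (hf : IsPick f) (h1 : 0 < f 1) {ξ : ℝ} (hξ : 0 < ξ) :
    IntegrableOn (fun ζ : ℝ => Real.log (f (ξ ^ 2 * ζ ^ 2)) / (1 + ζ ^ 2)) (Ioi 0) := by
  refine Integrable.mono' (integrableOn_dagger_bound |Real.log (f 1)| ξ)
    (hf.aestronglyMeasurable_dagger h1 hξ) ?_
  filter_upwards [ae_restrict_mem measurableSet_Ioi] with ζ hζ
  exact hf.norm_dagger_integrand_le h1 hξ hζ le_rfl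

/-- Only `log (fs n 1)` varies with `n` in the growth bound, and it converges, so one integrable
function dominates all the integrands. -/
lemma tendsto_dagger {fs : ℕ → ℝ → ℝ} (hfs : ∀ n, IsPick (fs n)) (hfs1 : ∀ n, 0 < fs n 1)
    (hf : IsPick f) (h1 : 0 < f 1)
    (h : ∀ x : ℝ, 0 < x → Tendsto (fun n => fs n x) atTop (𝓝 (f x))) {ξ : ℝ} (hξ : 0 < ξ) :
    Tendsto (fun n => dagger (fs n) ξ) atTop (𝓝 (dagger f ξ)) := by
  have hlog : Tendsto (fun n => |Real.log (fs n 1)|) atTop (𝓝 |Real.log (f 1)|) :=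
    ((h 1 one_pos).log h1.ne').abs
  obtain ⟨M, hM⟩ := hlog.bddAbove_range
  refine (Real.continuous_exp.tendsto _).comp (Tendsto.const_mul _ ?_)
  refine tendsto_integral_of_dominated_convergence _
    (fun n => (hfs n).aestronglyMeasurable_dagger (hfs1 n) hξ)
    (integrableOn_dagger_bound M ξ) (fun n => ?_) ?_
  · filter_upwards [ae_restrict_mem measurableSet_Ioi] with ζ hζ
    exact (hfs n).norm_dagger_integrand_le (hfs1 n) hξ hζ (hM ⟨n, rfl⟩)
  · filter_upwards [ae_restrict_mem measurableSet_Ioi] with ζ hζ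
    have hζ' : 0 < ζ := hζ
    have hx : 0 < ξ ^ 2 * ζ ^ 2 := by positivity
    exact ((h _ hx).log (hf.pos_of_one_pos h1 hx).ne').div_const _

/-- The dagger transform of a superposition of the kernels is again one, and the transforms
satisfy the Wiener–Hopf identity. -/
theorem exists_dagger {ρ : FiniteMeasure I} (hρ : ∀ x : ℝ, 0 < x → (f x : ℂ) = pickTransform ρ x)
    (h1 : 0 < f 1) :
    ∃ τ : FiniteMeasure I, (∀ x : ℝ, 0 < x → (dagger f x : ℂ) = pickTransform τ x) ∧
      ∀ ξ : ℂ, ξ.im ≠ 0 →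
        pickTransform τ ξ * pickTransform τ (-ξ) = pickTransform ρ (-ξ ^ 2) := by
  obtain ⟨C, α, s, hC, hα, hlim⟩ := exists_tendsto_prod (ρ : Measure I)
  let fs : ℕ → ℝ → ℝ := fun n x => C n * ∏ i, (x + α n i) / (x + s n i)
  have hfsC : ∀ n x, (fs n x : ℂ) = C n * ∏ i, ((x : ℂ) + α n i) / (x + s n i) := fun n x => by
    simp [fs]
  have hfs : ∀ n, IsPick (fs n) := fun n => by
    obtain ⟨τ, hτ⟩ := (hα n).exists_pickTransform_eq (hC n).le
    exact ⟨τ, fun x hx => by rw [← hτ x (ofReal_mem_slitPlane hx), hfsC]⟩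
  have hfs1 : ∀ n, 0 < fs n 1 := fun n => mul_pos (hC n) (Finset.prod_pos fun i _ =>
    div_pos (add_pos one_pos ((hα n).pos i)) (add_pos one_pos ((hα n).pos_right i)))
  have hfslim : ∀ x : ℝ, 0 < x → Tendsto (fun n => fs n x) atTop (𝓝 (f x)) := fun x hx => by
    have h2 := hlim x (ofReal_mem_slitPlane hx)
    rw [← hρ x hx] at h2
    simp_rw [← hfsC] at h2
    have h3 := (Complex.continuous_re.tendsto _).comp h2
    simpa only [Function.comp_def, Complex.ofReal_re] using h3
  choose τs hτs using fun n => (hα n).sqrt.exists_pickTransform_eq (Real.sqrt_nonneg (C n))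
  have hτlim : ∀ x : ℝ, 0 < x →
      Tendsto (fun n => pickTransform (τs n) x) atTop (𝓝 (dagger f x : ℂ)) := fun x hx => by
    have h2 := (Complex.continuous_ofReal.tendsto _).comp
      (tendsto_dagger hfs hfs1 ⟨ρ, hρ⟩ h1 hfslim hx)
    refine h2.congr fun n => ?_
    rw [Function.comp_apply, dagger_prod (hC n) (hα n).pos (hα n).pos_right (fun _ _ => rfl) hx,
      ← hτs n x (ofReal_mem_slitPlane hx)]
    push_cast
    rfl
  -- The transforms of `τs` are known to converge only on the half-line; weak convergence along `U`
  -- gives convergence at `ξ` and `-ξ` too.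
  obtain ⟨U, τ, hU, hτU, hτ⟩ := exists_ultrafilter_tendsto_finiteMeasure τs hτlim
  refine ⟨τ, hτ, fun ξ hξ => ?_⟩
  have hξ1 : ξ ∈ Complex.slitPlane := Or.inr hξ
  have hξ2 : -ξ ∈ Complex.slitPlane := Or.inr (by simpa using hξ)
  have hξ3 := neg_sq_mem_slitPlane hξ
  refine tendsto_nhds_unique ((tendsto_pickTransform hτU hξ1).mul (tendsto_pickTransform hτU hξ2))
    (((hlim _ hξ3).mono_left hU).congr fun n => ?_)
  rw [← hτs n ξ hξ1, ← hτs n (-ξ) hξ2]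
  have hsqrt : ∀ {c : ℝ}, 0 ≤ c → (c : ℂ) = ((√c : ℝ) : ℂ) * ((√c : ℝ) : ℂ) := fun {c} hc => by
    rw [← Complex.ofReal_mul, Real.mul_self_sqrt hc]
  rw [hsqrt (hC n).le, mul_mul_mul_comm, ← Finset.prod_mul_distrib]
  congr 1
  refine Finset.prod_congr rfl fun i _ => ?_
  rw [hsqrt ((hα n).pos i).le, hsqrt ((hα n).pos_right i).le, div_mul_div_comm]
  congr 1 <;> ring

end IsPick

theorem mainTheorem6 (ψ : ℝ → ℝ) (hψ : IsCompleteBernstein ψ)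
    (hne : ∃ x : ℝ, 0 < x ∧ ψ x ≠ 0) :
    -- `ψ` is positive and the integral defining `ψ†(ξ)` converges absolutely
    (∀ x : ℝ, 0 < x → 0 < ψ x) ∧
    (∀ ξ : ℝ, 0 < ξ →
      IntegrableOn (fun ζ : ℝ => Real.log (ψ (ξ ^ 2 * ζ ^ 2)) / (1 + ζ ^ 2)) (Ioi 0)) ∧
    IsCompleteBernstein (dagger ψ) ∧
    (∃ F : ℂ → ℂ, IsHolomorphicExtension ψ F) ∧
    (∃ G : ℂ → ℂ, IsHolomorphicExtension (dagger ψ) G) ∧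
    ∀ F G : ℂ → ℂ, IsHolomorphicExtension ψ F → IsHolomorphicExtension (dagger ψ) G →
      ∀ ξ : ℂ, ξ.im ≠ 0 → G ξ * G (-ξ) = F (-ξ ^ 2) := by
  obtain ⟨x₀, hx₀, hne⟩ := hne
  have hpick := hψ.isPick
  have h1 := hpick.one_pos_of_ne_zero hx₀ hne
  obtain ⟨ρ, hρ⟩ := hψ.isPick
  obtain ⟨τ, hτ, hWH⟩ := IsPick.exists_dagger hρ h1
  refine ⟨fun x hx => hpick.pos_of_one_pos h1 hx, fun ξ hξ => hpick.integrableOn_dagger h1 hξ,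
    IsPick.isCompleteBernstein ⟨τ, hτ⟩,
    ⟨pickTransform ρ, differentiableOn_pickTransform _, fun x hx => (hρ x hx).symm⟩,
    ⟨pickTransform τ, differentiableOn_pickTransform _, fun x hx => (hτ x hx).symm⟩,
    fun F G hF hG ξ hξ => ?_⟩
  -- An arbitrary extension must be the transform, so the identity holds for every choice of
  -- extensions.
  have hFρ := eqOn_slitPlane_of_eq_ofReal hF.differentiableOn
    (differentiableOn_pickTransform (ρ : Measure I)) fun x hx => by
      rw [hF.eq_ofReal x hx, hρ x hx]
  have hGτ := eqOn_slitPlane_of_eq_ofReal hG.differentiableOn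
    (differentiableOn_pickTransform (τ : Measure I)) fun x hx => by
      rw [hG.eq_ofReal x hx, hτ x hx]
  have hξ2 : -ξ ∈ Complex.slitPlane := Or.inr (by simpa using hξ)
  rw [hGτ (Or.inr hξ), hGτ hξ2, hFρ (neg_sq_mem_slitPlane hξ), hWH ξ hξ]
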